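/- Let $M$ be a four-dimensional spacetime: a smooth Hausdorff four-manifold with a time-oriented Lorentzian metric $g$ of class $C^1$. Suppose that $M$ is globally hyperbolic (it is strongly causal and all sets $J^+(x)\cap J^-(z)$ are compact), and that the geodesic equation (whose right-hand side is continuous, since $g$ is $C^1$) has a unique solution through each point $(q,v)$ of the tangent bundle: a geodesic with initial position $q$ and initial velocity $v$ exists locally, and any two of them agree on every common open parameter interval around the initial parameter. Let $\tau:M\to\mathbb R$ be a time function (continuous, and strictly increasing along every future-directed causal curve) whose slices $\mathcal C[t]=\{\tau=t\}$, $t\in[0,\infty)$, are Cauchy surfaces, i.e. every inextendible causal curve meets each of them exactly once. For $p\in M$ and a Cauchy surface $\Sigma$ let $C(p,\Sigma)$ be the set of continuous future-directed causal curves from $p$ to a point of $\Sigma$, where curves that differ by a reparametrization are identified, so that a curve is determined by the set of its points. Give it the topology with basis $O(U)=\{\lambda\in C(p,\Sigma)\mid \lambda\subset U\}$, $U\subset M$ open. Let $N(p,\Sigma)\subset C(p,\Sigma)$ be the subset of future-directed null geodesics from $p$ to a point of $\Sigma$, with the subspace topology. (If $p\in\Sigma$, the curve that consists of $p$ alone is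 counted as an element of both sets.) Let $p\in M$ and $t\in\mathbb R$ satisfy $0\le\tau(p)\le t$ (for instance $p\in\mathcal C[0]$ and $t\ge 0$). Then the wavefront $$S[t]=\bigcup_{\lambda\in N(p,\mathcal C[t])}\lambda\cap\mathcal C[t]\subset M$$ is arc-wise connected (non-empty and path connected), and $N(p,\mathcal C[t])$ is arc-wise connected (non-empty and path connected) in the above topology. -/

import Mathlib

open Set Filter Topology
open scoped Manifold ContDiff

namespace Wavefront

/-- The model space of a four-dimensional manifold. -/
abbrev E4 : Type := EuclideanSpace ℝ (Fin 4)

/-- The model with corners of a four-dimensional manifold without boundary. -/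
noncomputable abbrev I4 : ModelWithCorners ℝ E4 E4 := 𝓘(ℝ, E4)

variable {M : Type*} [TopologicalSpace M] [ChartedSpace E4 M]

/-- The components, in the chart `e`, of a field `g` of bilinear forms on the tangent spaces:
the pullback of `g` by the inverse chart, as a field of bilinear forms on `e.target`. -/
noncomputable def inChart
    (g : ∀ x : M, TangentSpace I4 x →L[ℝ] TangentSpace I4 x →L[ℝ] ℝ)
    (e : OpenPartialHomeomorph M E4) (y : E4) : E4 →L[ℝ] E4 →L[ℝ] ℝ :=
  let D : E4 →L[ℝ] E4 := mfderiv I4 I4 e.symm y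
  let B : E4 →L[ℝ] E4 →L[ℝ] ℝ := g (e.symm y)
  B.bilinearComp D D

variable (M) in
/-- A spacetime structure on a smooth four-dimensional manifold: a Lorentzian metric of signature
`(-,+,+,+)` whose components are of class `C¹` in every chart (so that the right-hand side of the
geodesic equation is continuous), and a time orientation, given by a continuous timelike vector
field. -/
structure Spacetime [IsManifold I4 ∞ M] where
  /-- the metric -/
  g : ∀ x : M, TangentSpace I4 x →L[ℝ] TangentSpace I4 x →L[ℝ] ℝ
  symm : ∀ x v w, g x v w = g x w v
  lorentzian : ∀ x : M, ∃ b : Module.Basis (Fin 4) ℝ (TangentSpace I4 x),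
    ∀ i j, g x (b i) (b j) = if i = j then (if i = 0 then -1 else 1) else 0
  contDiff : ∀ e ∈ atlas E4 M, ContDiffOn ℝ 1 (inChart g e) e.target
  /-- the vector field defining the future -/
  T : ∀ x : M, TangentSpace I4 x
  continuous_T : Continuous fun x => (⟨x, T x⟩ : TangentBundle I4 M)
  timelike_T : ∀ x, g x (T x) (T x) < 0

/-- The velocity vector of a curve. -/
noncomputable def velocity (γ : ℝ → M) (s : ℝ) : TangentSpace I4 (γ s) :=
  mfderiv 𝓘(ℝ, ℝ) I4 γ s (1 : ℝ)

/-- The pair of position and velocity of a curve, a point of the tangent bundle. -/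
noncomputable def tangentLift (γ : ℝ → M) (s : ℝ) : TangentBundle I4 M := ⟨γ s, velocity γ s⟩

variable [IsManifold I4 ∞ M]

namespace Spacetime

variable (S : Spacetime M)

/-- `v` is a future-directed causal (timelike or null) vector. -/
def FutureCausal {x : M} (v : TangentSpace I4 x) : Prop :=
  v ≠ 0 ∧ S.g x v v ≤ 0 ∧ S.g x (S.T x) v < 0

/-- `v` is a future-directed null vector. -/
def FutureNull {x : M} (v : TangentSpace I4 x) : Prop :=
  v ≠ 0 ∧ S.g x v v = 0 ∧ S.g x (S.T x) v < 0

/-- There is a future-directed causal `C¹` curve inside `U` from `x` to `y`. -/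
def CausalStep (U : Set M) (x y : M) : Prop :=
  ∃ (γ : ℝ → M) (a b : ℝ), a < b ∧ ContMDiffOn 𝓘(ℝ, ℝ) I4 1 γ (Icc a b) ∧
    (∀ s ∈ Icc a b, S.FutureCausal (mfderivWithin 𝓘(ℝ, ℝ) I4 γ (Icc a b) s (1 : ℝ))) ∧
    (∀ s ∈ Icc a b, γ s ∈ U) ∧ γ a = x ∧ γ b = y

/-- `y ∈ J⁺(x, U)`: either `y = x`, or there is a future-directed causal, piecewise `C¹` curve
inside `U` from `x` to `y`. -/
def CausallyPrecedes (U : Set M) (x y : M) : Prop :=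
  Relation.ReflTransGen (S.CausalStep U) x y

/-- The causal diamond `J⁺(x) ∩ J⁻(z)`. -/
def diamond (x z : M) : Set M :=
  {y | S.CausallyPrecedes univ x y ∧ S.CausallyPrecedes univ y z}

/-- Global hyperbolicity: strong causality (every point has arbitrarily small neighbourhoods `V`
such that causal curves with endpoints in `V` stay close to the point), and compactness of all
causal diamonds. -/
def GloballyHyperbolic : Prop :=
  (∀ x : M, ∀ U ∈ 𝓝 x, ∃ V ∈ 𝓝 x, ∀ y ∈ V, ∀ z ∈ V, S.diamond y z ⊆ U) ∧
    ∀ x z : M, IsCompact (S.diamond x z)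

/-- `γ` is a continuous future-directed causal curve on the set `I` of parameters (an interval):
locally, later points of the curve are causally after earlier ones and different from them. -/
def IsCausalCurveOn (γ : ℝ → M) (I : Set ℝ) : Prop :=
  ContinuousOn γ I ∧ ∀ s ∈ I, ∀ U ∈ 𝓝 (γ s), ∀ᶠ r in 𝓝[I] s,
    (s < r → S.CausallyPrecedes U (γ s) (γ r) ∧ γ r ≠ γ s) ∧
    (r < s → S.CausallyPrecedes U (γ r) (γ s) ∧ γ r ≠ γ s)

/-- A causal curve on the interval `I` is inextendible if it has neither a future nor a past
endpoint. (If `I` contains its supremum `b`, then `γ b` is a future endpoint.) -/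
def IsInextendibleCausalCurveOn (γ : ℝ → M) (I : Set ℝ) : Prop :=
  I.Nonempty ∧ I.OrdConnected ∧ S.IsCausalCurveOn γ I ∧
    (∀ q : M, ¬ Tendsto (fun s : I => γ s) atTop (𝓝 q)) ∧
    (∀ q : M, ¬ Tendsto (fun s : I => γ s) atBot (𝓝 q))

/-- A Cauchy surface: every inextendible causal curve meets it exactly once. -/
def IsCauchySurface (C : Set M) : Prop :=
  ∀ (γ : ℝ → M) (I : Set ℝ), S.IsInextendibleCausalCurveOn γ I → ∃! s, s ∈ I ∧ γ s ∈ C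

/-- The time slice `C[t]` of a function `τ`. -/
def slice (τ : M → ℝ) (t : ℝ) : Set M := τ ⁻¹' {t}

/-- `τ` is a time function (continuous, and strictly increasing along future-directed causal
curves) whose slices `C[t]`, `t ∈ [0, ∞)`, are Cauchy surfaces. -/
def IsCauchySlicing (τ : M → ℝ) : Prop :=
  Continuous τ ∧
    (∀ (γ : ℝ → M) (I : Set ℝ), I.OrdConnected → S.IsCausalCurveOn γ I →
      StrictMonoOn (τ ∘ γ) I) ∧
    ∀ t : ℝ, 0 ≤ t → S.IsCauchySurface (slice τ t)

/-- `γ` is an affinely parametrized geodesic on the open set `J` of parameters: in every chart it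
is of class `C²` and satisfies the geodesic equation `x'' + Γ(x', x') = 0`. The equation is
written with its index lowered, `g(x'', w) + (∂_{x'} g)(x', w) - (1/2) (∂_w g)(x', x') = 0` for all
`w`, where the last two terms are the Christoffel symbol of the first kind. -/
def IsGeodesicOn (γ : ℝ → M) (J : Set ℝ) : Prop :=
  ContinuousOn γ J ∧ ∀ e ∈ atlas E4 M, ∀ s ∈ J, γ s ∈ e.source →
    ContDiffAt ℝ 2 (e ∘ γ) s ∧
    ∀ w : E4,
      inChart S.g e (e (γ s)) (deriv (deriv (e ∘ γ)) s) w
        + fderiv ℝ (inChart S.g e) (e (γ s)) (deriv (e ∘ γ) s) (deriv (e ∘ γ) s) w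
        - (1 / 2) * fderiv ℝ (inChart S.g e) (e (γ s)) w (deriv (e ∘ γ) s) (deriv (e ∘ γ) s) = 0

/-- Through each point of the tangent bundle there is a unique solution of the geodesic equation:
for every initial position and velocity a geodesic exists near parameter `0`, and any two
geodesics with the same initial position and velocity agree on every common interval. -/
def HasUniqueGeodesics : Prop :=
  (∀ z : TangentBundle I4 M, ∃ ε > 0, ∃ γ : ℝ → M,
    S.IsGeodesicOn γ (Ioo (-ε) ε) ∧ tangentLift γ 0 = z) ∧
  ∀ (J : Set ℝ) (γ₁ γ₂ : ℝ → M), IsOpen J → J.OrdConnected → (0 : ℝ) ∈ J →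
    S.IsGeodesicOn γ₁ J → S.IsGeodesicOn γ₂ J → tangentLift γ₁ 0 = tangentLift γ₂ 0 →
    EqOn γ₁ γ₂ J

/-- `C(p, C)`: the continuous future-directed causal curves from `p` to a point of `C`, up to
reparametrization. A curve is represented by the set of its points; for a spacetime without closed
causal curves this set determines the curve up to reparametrization. The curve that consists of
the single point `p` is allowed (it belongs to `C(p, C)` if `p ∈ C`). -/
@[ext]
structure CausalCurve (p : M) (C : Set M) where
  /-- the set of points of the curve -/
  carrier : Set M
  isCausal : ∃ (γ : ℝ → M) (a b : ℝ), a ≤ b ∧ S.IsCausalCurveOn γ (Icc a b) ∧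
    γ a = p ∧ γ b ∈ C ∧ γ '' Icc a b = carrier

/-- The topology of `C(p, C)` with basis `O(U) = {λ | λ ⊆ U}`, `U` open in `M`. -/
instance (p : M) (C : Set M) : TopologicalSpace (S.CausalCurve p C) :=
  TopologicalSpace.generateFrom
    {O | ∃ U : Set M, IsOpen U ∧ O = {c : S.CausalCurve p C | c.carrier ⊆ U}}

/-- `N(p, C)`: the future-directed null geodesics from `p` to a point of `C`, as a subset of
`C(p, C)`. -/
def nullGeodesics (p : M) (C : Set M) : Set (S.CausalCurve p C) :=
  {c | ∃ (γ : ℝ → M) (J : Set ℝ) (b : ℝ), IsOpen J ∧ J.OrdConnected ∧ 0 ≤ b ∧ Icc 0 b ⊆ J ∧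
    S.IsGeodesicOn γ J ∧ (∀ s ∈ J, S.FutureNull (velocity γ s)) ∧
    γ 0 = p ∧ γ b ∈ C ∧ γ '' Icc 0 b = c.carrier}

/-- The wavefront: the set of the points in which the null geodesics in `N(p, C)` meet `C`. -/
def wavefront (p : M) (C : Set M) : Set M :=
  ⋃ c ∈ S.nullGeodesics p C, c.carrier ∩ C

end Spacetime

end Wavefront

/-! The future null vectors at `p` form a punctured half-cone, parametrized by its spatial part in
`ℝ³ \ {0}`, hence path connected (`isPathConnected_futureNull`). Sending such a vector to the null
geodesic it generates, cut off at the slice, maps the cone onto `N(p, C[t])`, and sending a curve to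
its endpoint maps `N(p, C[t])` onto the wavefront. Both maps are continuous, so both images are path
connected.

Two points need work because the geodesic equation has a merely continuous right-hand side.
Continuity of the first map rests on continuous dependence on initial data (`eventually_flow_mem`).
It comes from uniqueness and compactness: limits of solutions are solutions
(`exists_hasDerivAt_of_ultrafilter`), and only one solution starts at a given point of the tangent
bundle.

The map is defined everywhere because a maximal null geodesic reaches the slice, for which it must
be inextendible as a causal curve (`exists_leaving_nhds`). If it stayed near a point, a linear
functional `f` comparable to the norm on null vectors would satisfy `|f(x'')| ≤ C f(x')²`. This
keeps velocities bounded and the parameter range finite, and a uniform existence time then continues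
the geodesic past its maximal domain. -/

namespace Wavefront

/-! ### Ordinary differential equations with continuous right-hand side -/

section ODE

variable {F : Type*} [NormedAddCommGroup F] [NormedSpace ℝ F]

/-- Pointwise limits along an ultrafilter of solutions of approximate equations solve the limit
equation. -/
theorem exists_hasDerivAt_of_ultrafilter {ι : Type*} (l : Ultrafilter ι) {f : F → F} {K : Set F}
    (hK : IsCompact K) (hf : ContinuousOn f K) {g : ι → F → F}
    (hg : ∀ η > 0, ∀ᶠ i in (l : Filter ι), ∀ x ∈ K, ‖g i x - f x‖ ≤ η)
    {α : ι → ℝ → F} {a b : ℝ}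
    (hα : ∀ᶠ i in (l : Filter ι), ∀ s ∈ Ioo a b, HasDerivAt (α i) (g i (α i s)) s ∧ α i s ∈ K) :
    ∃ β : ℝ → F, ∀ s ∈ Ioo a b, β s ∈ K ∧ HasDerivAt β (f (β s)) s ∧
      Tendsto (fun i => α i s) l (𝓝 (β s)) := by
  -- Along an ultrafilter every `K`-valued family converges, so limits are taken parameter by
  -- parameter, without the Arzelà–Ascoli theorem.
  have hlim : ∀ s, ∃ y, s ∈ Ioo a b → y ∈ K ∧ Tendsto (fun i => α i s) l (𝓝 y) := by
    intro s
    by_cases hs : s ∈ Ioo a b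
    · have : ((l.map fun i => α i s : Ultrafilter F) : Filter F) ≤ 𝓟 K := by
        rw [le_principal_iff, Ultrafilter.coe_map, mem_map]
        filter_upwards [hα] with i hi using (hi s hs).2
      obtain ⟨y, hy, h⟩ := hK.ultrafilter_le_nhds _ this
      exact ⟨y, fun _ => ⟨hy, h⟩⟩
    · exact ⟨0, fun h => absurd h hs⟩
  choose β hβ using hlim
  refine ⟨β, fun s hs => ⟨(hβ s hs).1, ?_, (hβ s hs).2⟩⟩
  obtain ⟨L, hL⟩ := (hK.bddAbove_image hf.norm)
  have hL' : ∀ x ∈ K, ‖f x‖ ≤ L := fun x hx => hL (mem_image_of_mem _ hx)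
  have hL0 : 0 ≤ L := (norm_nonneg _).trans (hL' _ (hβ s hs).1)
  rw [hasDerivAt_iff_isLittleO, Asymptotics.isLittleO_iff]
  intro c hc
  obtain ⟨δ, hδ, hfδ⟩ := Metric.uniformContinuousOn_iff.1
    (hK.uniformContinuousOn_of_continuous hf) (c / 4) (by positivity)
  have hev : ∀ᶠ r in 𝓝 s, r ∈ Ioo a b ∧ (L + c) * |r - s| < δ := by
    refine Eventually.and (Ioo_mem_nhds hs.1 hs.2) ?_
    have : Tendsto (fun r => (L + c) * |r - s|) (𝓝 s) (𝓝 ((L + c) * |s - s|)) :=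
      (by fun_prop : Continuous fun r => (L + c) * |r - s|).tendsto s
    exact this.eventually_lt_const (by simpa using hδ)
  filter_upwards [hev] with r hr
  have hseg : uIcc s r ⊆ Ioo a b := ordConnected_Ioo.uIcc_subset hs hr.1
  -- The bound is uniform in `i`, so it survives the limit: speeds at most `L + c` keep `α i` within
  -- `δ` of `α i s`, where `f` varies by less than `c / 4`, and `g i` differs from `f` by at most `c
  -- / 4`.
  have hbd : ∀ᶠ i in (l : Filter ι), ‖α i r - α i s - (r - s) • f (α i s)‖ ≤ c * ‖r - s‖ := by
    filter_upwards [hα, hg (c / 4) (by positivity)] with i hi hgi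
    have h1 : ∀ q ∈ uIcc s r, ‖α i q - α i s‖ ≤ (L + c) * ‖q - s‖ := by
      intro q hq
      refine (convex_uIcc s r).norm_image_sub_le_of_norm_hasDerivWithin_le
        (f' := fun q => g i (α i q))
        (fun x hx => (hi x (hseg hx)).1.hasDerivWithinAt) (fun x hx => ?_) left_mem_uIcc hq
      have h2 := hgi _ (hi x (hseg hx)).2
      have h3 := hL' _ (hi x (hseg hx)).2
      have h4 := norm_add_le (g i (α i x) - f (α i x)) (f (α i x))
      rw [sub_add_cancel] at h4
      linarith
    have h5 := (convex_uIcc s r).norm_image_sub_le_of_norm_hasDerivWithin_le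
        (f := fun q => α i q - (q - s) • f (α i s)) (f' := fun q => g i (α i q) - f (α i s))
        (C := c)
        (fun x hx => by
          have h6 := ((hasDerivAt_id x).sub_const s).smul_const (f (α i s))
          rw [one_smul] at h6
          exact ((hi x (hseg hx)).1.sub h6).hasDerivWithinAt) (fun x hx => ?_)
        (left_mem_uIcc : s ∈ uIcc s r) right_mem_uIcc
    · have e : α i r - α i s - (r - s) • f (α i s) =
        (α i r - (r - s) • f (α i s)) - (α i s - (s - s) • f (α i s)) := by
        simp only [sub_self, zero_smul, sub_zero]; abel
      rw [e]; exact h5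
    · have h2 := hgi _ (hi x (hseg hx)).2
      have h7 : dist (α i x) (α i s) < δ := by
        rw [dist_eq_norm]
        refine (h1 x hx).trans_lt (lt_of_le_of_lt ?_ hr.2)
        refine mul_le_mul_of_nonneg_left ?_ (by positivity)
        rw [Real.norm_eq_abs]
        exact abs_sub_left_of_mem_uIcc hx
      have h8 := hfδ _ (hi x (hseg hx)).2 _ (hi s hs).2 h7
      rw [dist_eq_norm] at h8
      have h4 := norm_add_le (g i (α i x) - f (α i x)) (f (α i x) - f (α i s))
      rw [sub_add_sub_cancel] at h4
      linarith
  have hfs : Tendsto (fun i => f (α i s)) l (𝓝 (f (β s))) := by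
    refine (hf _ (hβ s hs).1).tendsto.comp (tendsto_nhdsWithin_iff.2 ⟨(hβ s hs).2, ?_⟩)
    filter_upwards [hα] with i hi using (hi s hs).2
  exact le_of_tendsto
    ((((hβ r hr.1).2.sub (hβ s hs).2).sub (hfs.const_smul (r - s))).norm) hbd

/-- Solutions of a Lipschitz equation that stay in a given ball. -/
theorem exists_hasDerivAt_mem_closedBall_of_lipschitz [CompleteSpace F] {f : F → F} {z₀ : F}
    {r L K : NNReal} {ε : ℝ} (hε : 0 < ε) (hL : ∀ x ∈ Metric.closedBall z₀ r, ‖f x‖ ≤ L)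
    (hK : LipschitzOnWith K f (Metric.closedBall z₀ r)) (hεL : L * ε ≤ r - (r / 2 : NNReal))
    {z : F} (hz : z ∈ Metric.closedBall z₀ (r / 2 : NNReal)) :
    ∃ α : ℝ → F, α 0 = z ∧ ∀ s ∈ Ioo (-ε) ε,
      HasDerivAt α (f (α s)) s ∧ α s ∈ Metric.closedBall z₀ r := by
  have h0 : (0 : ℝ) ∈ Icc (-ε) ε := ⟨by linarith, hε.le⟩
  have hf : IsPicardLindelof (fun _ : ℝ => f) (⟨0, h0⟩ : Icc (-ε) ε) z₀ r (r / 2) L K :=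
    .of_time_independent hL hK (by simpa using hεL)
  -- The Picard fixed point is used directly because membership in `FunSpace` confines it to the
  -- ball.
  obtain ⟨α, hα⟩ := ODE.FunSpace.exists_isFixedPt_next hf hz
  have hmem : ∀ s, α.compProj s ∈ Metric.closedBall z₀ r := fun s =>
    α.compProj_mem_closedBall hf.mul_max_le
  have h00 : α.compProj 0 = z := by
    have h : α.compProj 0 = α ⟨0, h0⟩ := ODE.FunSpace.compProj_of_mem h0
    rw [h, ← hα]
    exact ODE.FunSpace.next_apply₀ hf hz α
  refine ⟨α.compProj, h00, fun s hs => ⟨?_, hmem s⟩⟩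
  have h := ODE.hasDerivWithinAt_picard_Icc h0 hf.continuousOn_uncurry
    α.continuous_compProj.continuousOn (fun _ _ => hmem _) z (Ioo_subset_Icc_self hs)
  refine (h.hasDerivAt (Icc_mem_nhds hs.1 hs.2)).congr_of_eventuallyEq ?_
  filter_upwards [Icc_mem_nhds hs.1 hs.2] with q hq
  rw [ODE.FunSpace.compProj_of_mem hq]
  exact (ODE.FunSpace.isFixedPt_next_iff hf hz).1 hα ⟨q, hq⟩

/-- Peano's theorem, with a uniform time of existence. -/
theorem exists_hasDerivAt_mem_closedBall [FiniteDimensional ℝ F] {f : F → F} {z₀ : F}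
    {r L : NNReal} {ε : ℝ} (hε : 0 < ε) (hf : ContinuousOn f (Metric.closedBall z₀ r))
    (hL : ∀ x ∈ Metric.closedBall z₀ r, ‖f x‖ ≤ L)
    (hεL : (L + 1) * ε ≤ r - (r / 2 : NNReal))
    {z : F} (hz : z ∈ Metric.closedBall z₀ (r / 2 : NNReal)) :
    ∃ α : ℝ → F, α 0 = z ∧ ∀ s ∈ Ioo (-ε) ε,
      HasDerivAt α (f (α s)) s ∧ α s ∈ Metric.closedBall z₀ r := by
  have : ProperSpace F := FiniteDimensional.proper ℝ F
  have : CompleteSpace F := FiniteDimensional.complete ℝ F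
  set B := Metric.closedBall z₀ (r : ℝ) with hB
  have hBc : IsCompact B := isCompact_closedBall _ _
  have happ : ∀ n : ℕ, ∃ g : F → F, ContDiff ℝ 1 g ∧ ∀ x ∈ B, ‖g x - f x‖ ≤ 1 / (n + 1) := by
    intro n
    have hn : (0 : ℝ) < 1 / (n + 1) := by positivity
    -- A partition of unity glues locally constant approximations of `f`; off `B` the constraint is
    -- vacuous.
    obtain ⟨g, hg⟩ := exists_contMDiffMap_forall_mem_convex_of_local_const (n := 1) 𝓘(ℝ, F)
      (t := fun x => {y : F | x ∈ B → y ∈ Metric.closedBall (f x) (1 / (n + 1))})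
      (fun x => by
        by_cases hx : x ∈ B
        · simp only [hx, true_imp_iff]
          exact convex_closedBall (f x) (1 / (n + 1) : ℝ)
        · simpa [hx] using convex_univ)
      (fun x => by
        by_cases hx : x ∈ B
        · refine ⟨f x, ?_⟩
          have h := (hf x hx).eventually (Metric.closedBall_mem_nhds (f x) hn)
          rw [eventually_nhdsWithin_iff] at h
          filter_upwards [h] with y hy hyB
          rw [Metric.mem_closedBall_comm]; exact hy hyB
        · refine ⟨0, ?_⟩
          filter_upwards [hBc.isClosed.isOpen_compl.mem_nhds hx] with y hy hyB
          exact absurd hyB hy)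
    exact ⟨g, g.contMDiff.contDiff, fun x hx => by
      simpa [dist_eq_norm] using hg x hx⟩
  choose g hgc hg using happ
  have hsol : ∀ n, ∃ α : ℝ → F, α 0 = z ∧ ∀ s ∈ Ioo (-ε) ε,
      HasDerivAt α (g n (α s)) s ∧ α s ∈ B := by
    intro n
    obtain ⟨K, hK⟩ : ∃ K, LipschitzOnWith K (g n) B :=
      ((hgc n).locallyLipschitz.locallyLipschitzOn).exists_lipschitzOnWith_of_compact hBc
    -- The extra `1` in the speed bound absorbs the approximation error `1 / (n + 1)`.
    refine exists_hasDerivAt_mem_closedBall_of_lipschitz (L := L + 1) hε (fun x hx => ?_) hK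
      (by simpa using hεL) hz
    have h1 := hg n x hx
    have h2 := hL x hx
    have h3 : (1 : ℝ) / (n + 1) ≤ 1 := by
      rw [div_le_one (by positivity)]; linarith [(Nat.cast_nonneg n : (0 : ℝ) ≤ n)]
    have h4 := norm_add_le (g n x - f x) (f x)
    rw [sub_add_cancel] at h4
    push_cast
    linarith
  choose α hα0 hα using hsol
  obtain ⟨β, hβ⟩ := exists_hasDerivAt_of_ultrafilter (hyperfilter ℕ) hBc hf (g := g) (α := α)
    (a := -ε) (b := ε) (fun η hη => by
      have h := tendsto_one_div_add_atTop_nhds_zero_nat.eventually_lt_const hη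
      filter_upwards [Nat.hyperfilter_le_atTop h] with n hn x hx
      exact (hg n x hx).trans hn.le) (Eventually.of_forall hα)
  refine ⟨β, ?_, fun s hs => ⟨(hβ s hs).2.1, (hβ s hs).1⟩⟩
  have h := (hβ 0 ⟨by linarith, hε⟩).2.2
  simp only [hα0] at h
  exact (tendsto_nhds_unique h tendsto_const_nhds)

end ODE

/-! ### The geodesic equation under a change of coordinates -/

section GeodesicForm

variable {E : Type*} [NormedAddCommGroup E] [NormedSpace ℝ E]

/-- The left-hand side of the geodesic equation with lowered index, for the metric components `G`,
at position `y`, velocity `v` and acceleration `a`. -/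
noncomputable def geodesicForm (G : E → E →L[ℝ] E →L[ℝ] ℝ) (y v a w : E) : ℝ :=
  G y a w + fderiv ℝ G y v v w - (1 / 2) * fderiv ℝ G y w v v

/-- Product rule for a pulled-back metric: one term differentiates `G'`, the other two differentiate
`fderiv ℝ φ` in either slot. -/
theorem fderiv_bilinearComp_fderiv {G G' : E → E →L[ℝ] E →L[ℝ] ℝ} {φ : E → E} {y : E}
    (hG' : DifferentiableAt ℝ G' (φ y)) (hφ : ContDiffAt ℝ 2 φ y)
    (hG : G =ᶠ[𝓝 y] fun x => (G' (φ x)).bilinearComp (fderiv ℝ φ x) (fderiv ℝ φ x))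
    (hdG : DifferentiableAt ℝ G y) (w u v : E) :
    fderiv ℝ G y w u v = fderiv ℝ G' (φ y) (fderiv ℝ φ y w) (fderiv ℝ φ y u) (fderiv ℝ φ y v)
      + G' (φ y) (fderiv ℝ (fderiv ℝ φ) y w u) (fderiv ℝ φ y v)
      + G' (φ y) (fderiv ℝ φ y u) (fderiv ℝ (fderiv ℝ φ) y w v) := by
  have hφ1 : HasFDerivAt φ (fderiv ℝ φ y) y :=
    (hφ.differentiableAt (by norm_num)).hasFDerivAt
  have hφ2 : HasFDerivAt (fderiv ℝ φ) (fderiv ℝ (fderiv ℝ φ) y) y :=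
    ((hφ.fderiv_right (m := 1) (by norm_num)).differentiableAt (by norm_num)).hasFDerivAt
  have h1 : HasFDerivAt (fun x => G' (φ x) (fderiv ℝ φ x u) (fderiv ℝ φ x v)) _ y :=
    ((hG'.hasFDerivAt.comp y hφ1).clm_apply (hφ2.clm_apply (hasFDerivAt_const u y))).clm_apply
      (hφ2.clm_apply (hasFDerivAt_const v y))
  have h2 : HasFDerivAt (fun x => G x u v) _ y :=
    (hdG.hasFDerivAt.clm_apply (hasFDerivAt_const u y)).clm_apply (hasFDerivAt_const v y)
  have h3 : (fun x => G x u v) =ᶠ[𝓝 y] fun x => G' (φ x) (fderiv ℝ φ x u) (fderiv ℝ φ x v) := by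
    filter_upwards [hG] with x hx
    rw [hx]; rfl
  have h4 := h2.unique (h1.congr_of_eventuallyEq h3)
  have h5 := congrArg (fun T : E →L[ℝ] ℝ => T w) h4
  simp at h5
  linarith

/-- Of the terms with second derivatives of `φ`, symmetry of the metric and of the second derivative
cancels all but one, which is the correction to the acceleration. With the index lowered, no inverse
metric enters. -/
theorem geodesicForm_comp {G G' : E → E →L[ℝ] E →L[ℝ] ℝ} {φ : E → E} {y : E}
    (hG' : DifferentiableAt ℝ G' (φ y)) (hφ : ContDiffAt ℝ 2 φ y)
    (hG : G =ᶠ[𝓝 y] fun x => (G' (φ x)).bilinearComp (fderiv ℝ φ x) (fderiv ℝ φ x))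
    (hdG : DifferentiableAt ℝ G y) (hsymm : ∀ u v, G' (φ y) u v = G' (φ y) v u) (v a w : E) :
    geodesicForm G y v a w = geodesicForm G' (φ y) (fderiv ℝ φ y v)
      (fderiv ℝ φ y a + fderiv ℝ (fderiv ℝ φ) y v v) (fderiv ℝ φ y w) := by
  have hs : fderiv ℝ (fderiv ℝ φ) y w v = fderiv ℝ (fderiv ℝ φ) y v w :=
    hφ.isSymmSndFDerivAt (by simp) w v
  have hGy : G y a w = G' (φ y) (fderiv ℝ φ y a) (fderiv ℝ φ y w) := by
    rw [hG.self_of_nhds]; rfl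
  simp only [geodesicForm, fderiv_bilinearComp_fderiv hG' hφ hG hdG, hGy, map_add,
    _root_.add_apply, hs]
  rw [hsymm (fderiv ℝ (fderiv ℝ φ) y v w)]
  ring

theorem contDiffAt_deriv_curve {x : ℝ → E} {s : ℝ} (hx : ContDiffAt ℝ 2 x s) :
    ContDiffAt ℝ 1 (deriv x) s := by
  have h := (hx.fderiv_right (m := 1) (by norm_num)).clm_apply
    (contDiffAt_const (c := (1 : ℝ)))
  simpa only [fderiv_apply_one_eq_deriv] using h

theorem deriv_comp_curve {φ : E → E} {x : ℝ → E} {s : ℝ} (hφ : ContDiffAt ℝ 2 φ (x s))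
    (hx : ContDiffAt ℝ 2 x s) :
    deriv (φ ∘ x) s = fderiv ℝ φ (x s) (deriv x s) ∧
    deriv (deriv (φ ∘ x)) s = fderiv ℝ φ (x s) (deriv (deriv x) s)
      + fderiv ℝ (fderiv ℝ φ) (x s) (deriv x s) (deriv x s) := by
  have hφ2 : HasFDerivAt (fderiv ℝ φ) (fderiv ℝ (fderiv ℝ φ) (x s)) (x s) :=
    ((hφ.fderiv_right (m := 1) (by norm_num)).differentiableAt (by norm_num)).hasFDerivAt
  have hx1 : HasDerivAt x (deriv x s) s := (hx.differentiableAt (by norm_num)).hasDerivAt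
  have hx2 : HasDerivAt (deriv x) (deriv (deriv x) s) s :=
    ((contDiffAt_deriv_curve hx).differentiableAt (by norm_num)).hasDerivAt
  have h1 : deriv (φ ∘ x) =ᶠ[𝓝 s] fun r => fderiv ℝ φ (x r) (deriv x r) := by
    have e1 : ∀ᶠ r in 𝓝 s, ContDiffAt ℝ 2 φ (x r) :=
      hx.continuousAt.eventually (hφ.eventually (by norm_num))
    filter_upwards [e1, hx.eventually (by norm_num)] with r h1 h2
    exact ((h1.differentiableAt (by norm_num)).hasFDerivAt.comp_hasDerivAt r
      (h2.differentiableAt (by norm_num)).hasDerivAt).deriv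
  refine ⟨h1.self_of_nhds, ?_⟩
  rw [EventuallyEq.deriv_eq h1]
  have := (hφ2.comp_hasDerivAt s hx1).clm_apply hx2
  simpa [add_comm] using this.deriv

end GeodesicForm

/-! ### Chart independence of the geodesic equation -/

section ChartChange

variable {M : Type*} [TopologicalSpace M] [ChartedSpace E4 M] [IsManifold I4 ∞ M]

theorem contDiffAt_chart_change {e e' : OpenPartialHomeomorph M E4} (he : e ∈ atlas E4 M)
    (he' : e' ∈ atlas E4 M) {x : M} (hx : x ∈ e.source) (hx' : x ∈ e'.source) :
    ContDiffAt ℝ 2 (e' ∘ e.symm) (e x) := by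
  have h1 : ContMDiffAt I4 I4 ∞ e.symm (e x) :=
    contMDiffAt_symm_of_mem_maximalAtlas (IsManifold.subset_maximalAtlas he) (e.map_source hx)
  have h2 : ContMDiffAt I4 I4 ∞ e' (e.symm (e x)) :=
    contMDiffAt_of_mem_maximalAtlas (IsManifold.subset_maximalAtlas he')
      (by rwa [e.left_inv hx])
  exact ((h2.comp _ h1).contDiffAt).of_le (WithTop.coe_le_coe.2 (le_top : (2 : ℕ∞) ≤ ⊤))

theorem mdifferentiableAt_of_mem_atlas {e : OpenPartialHomeomorph M E4} (he : e ∈ atlas E4 M)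
    {x : M} (hx : x ∈ e.source) : MDifferentiableAt I4 I4 e x :=
  have : IsManifold I4 1 M := IsManifold.of_le (n := ∞) (by exact_mod_cast le_top)
  mdifferentiableAt_atlas he hx

theorem mdifferentiableAt_symm_of_mem_atlas {e : OpenPartialHomeomorph M E4}
    (he : e ∈ atlas E4 M) {y : E4} (hy : y ∈ e.target) : MDifferentiableAt I4 I4 e.symm y :=
  have : IsManifold I4 1 M := IsManifold.of_le (n := ∞) (by exact_mod_cast le_top)
  mdifferentiableAt_atlas_symm he hy

theorem mfderiv_symm_comp {e e' : OpenPartialHomeomorph M E4} (he : e ∈ atlas E4 M)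
    (he' : e' ∈ atlas E4 M) {x : M} (hx : x ∈ e.source) (hx' : x ∈ e'.source) (u : E4) :
    (mfderiv I4 I4 e.symm (e x) u : E4) =
      mfderiv I4 I4 e'.symm (e' x) (fderiv ℝ (e' ∘ e.symm) (e x) u) := by
  have hev : e.symm =ᶠ[𝓝 (e x)] e'.symm ∘ (e' ∘ e.symm) := by
    have h1 : ∀ᶠ y in 𝓝 (e x), e.symm y ∈ e'.source :=
      (e.continuousAt_symm (e.map_source hx)).eventually
        (by rw [e.left_inv hx]; exact e'.open_source.mem_nhds hx')
    filter_upwards [h1] with y hy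
    exact (e'.left_inv hy).symm
  have hφ : (e' ∘ e.symm) (e x) = e' x := by simp [e.left_inv hx]
  have h2 : MDifferentiableAt I4 I4 e'.symm ((e' ∘ e.symm) (e x)) := by
    rw [hφ]; exact mdifferentiableAt_symm_of_mem_atlas he' (e'.map_source hx')
  have h3 : MDifferentiableAt I4 I4 (e' ∘ e.symm) (e x) :=
    ((contDiffAt_chart_change he he' hx hx').differentiableAt (by norm_num)).mdifferentiableAt
  have h4 := mfderiv_comp (e x) h2 h3
  rw [hev.mfderiv_eq]
  erw [h4]
  rw [mfderiv_eq_fderiv]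
  -- The two base points are equal only propositionally, so the point is generalized before
  -- substituting.
  have : ∀ y, y = e' x → (mfderiv I4 I4 e'.symm y : E4 →L[ℝ] E4) (fderiv ℝ (e' ∘ e.symm) (e x) u)
     = (mfderiv I4 I4 e'.symm (e' x) : E4 →L[ℝ] E4) (fderiv ℝ (e' ∘ e.symm) (e x) u) := by
    rintro y rfl; rfl
  exact this _ hφ

variable (S : Spacetime M)

theorem Spacetime.inChart_apply (e : OpenPartialHomeomorph M E4) {x : M} (hx : x ∈ e.source)
    (u v : E4) : inChart S.g e (e x) u v =
      S.g x (mfderiv I4 I4 e.symm (e x) u : E4) (mfderiv I4 I4 e.symm (e x) v : E4) := by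
  have : ∀ x' : M, x' = x → ∀ a b : E4, (S.g x' : E4 →L[ℝ] E4 →L[ℝ] ℝ) a b
      = (S.g x : E4 →L[ℝ] E4 →L[ℝ] ℝ) a b := by rintro _ rfl _ _; rfl
  exact this _ (e.left_inv hx) _ _

/-- Supplies `hG` of `geodesicForm_comp`; a whole neighbourhood is needed since the metric gets
differentiated. -/
theorem Spacetime.inChart_change {e e' : OpenPartialHomeomorph M E4} (he : e ∈ atlas E4 M)
    (he' : e' ∈ atlas E4 M) {x : M} (hx : x ∈ e.source) (hx' : x ∈ e'.source) :
    inChart S.g e =ᶠ[𝓝 (e x)] fun y => (inChart S.g e' ((e' ∘ e.symm) y)).bilinearComp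
      (fderiv ℝ (e' ∘ e.symm) y) (fderiv ℝ (e' ∘ e.symm) y) := by
  have h1 : ∀ᶠ y in 𝓝 (e x), e.symm y ∈ e'.source :=
    (e.continuousAt_symm (e.map_source hx)).eventually
      (by rw [e.left_inv hx]; exact e'.open_source.mem_nhds hx')
  filter_upwards [h1, e.open_target.mem_nhds (e.map_source hx)] with y hy hyt
  obtain ⟨z, hz, rfl⟩ : ∃ z ∈ e.source, e z = y := ⟨e.symm y, e.map_target hyt, e.right_inv hyt⟩
  rw [e.left_inv hz] at hy
  ext1 u; ext1 v
  rw [S.inChart_apply e hz]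
  have : (e' ∘ e.symm) (e z) = e' z := by simp [e.left_inv hz]
  rw [ContinuousLinearMap.bilinearComp_apply, this, S.inChart_apply e' hy,
    mfderiv_symm_comp he he' hz hy, mfderiv_symm_comp he he' hz hy]

theorem Spacetime.inChart_symm (e : OpenPartialHomeomorph M E4) (y u v : E4) :
    inChart S.g e y u v = inChart S.g e y v u := S.symm _ _ _

theorem Spacetime.differentiableAt_inChart {e : OpenPartialHomeomorph M E4} (he : e ∈ atlas E4 M)
    {y : E4} (hy : y ∈ e.target) : DifferentiableAt ℝ (inChart S.g e) y :=
  ((S.contDiff e he).contDiffAt (e.open_target.mem_nhds hy)).differentiableAt (by norm_num)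

/-- The geodesic equation in the chart `e` at the parameter `s`. -/
def Spacetime.GeodesicAt (e : OpenPartialHomeomorph M E4) (γ : ℝ → M) (s : ℝ) : Prop :=
  ContDiffAt ℝ 2 (e ∘ γ) s ∧ ∀ w : E4, geodesicForm (inChart S.g e) (e (γ s)) (deriv (e ∘ γ) s)
    (deriv (deriv (e ∘ γ)) s) w = 0

variable {S}

/-- The geodesic equation does not depend on the chart. -/
theorem Spacetime.GeodesicAt.change {e e' : OpenPartialHomeomorph M E4} (he : e ∈ atlas E4 M)
    (he' : e' ∈ atlas E4 M) {γ : ℝ → M} {s : ℝ} (hγ : ContinuousAt γ s) (hx : γ s ∈ e.source)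
    (hx' : γ s ∈ e'.source) (h : S.GeodesicAt e γ s) : S.GeodesicAt e' γ s := by
  have hev : e' ∘ γ =ᶠ[𝓝 s] (e' ∘ e.symm) ∘ (e ∘ γ) := by
    filter_upwards [hγ (e.open_source.mem_nhds hx)] with r hr
    simp [e.left_inv hr]
  have hφ : ContDiffAt ℝ 2 (e' ∘ e.symm) ((e ∘ γ) s) := contDiffAt_chart_change he he' hx hx'
  have hφs : (e' ∘ e.symm) (e (γ s)) = e' (γ s) := by simp [e.left_inv hx]
  refine ⟨(hφ.comp s h.1).congr_of_eventuallyEq hev, fun w => ?_⟩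
  obtain ⟨h1, h2⟩ := deriv_comp_curve hφ h.1
  rw [hev.deriv_eq, hev.deriv.deriv_eq, h1, h2]
  have hψ : ContDiffAt ℝ 2 (e ∘ e'.symm) ((e' ∘ γ) s) := contDiffAt_chart_change he' he hx' hx
  -- The derivative of the transition map is surjective, so every test vector in `e'` comes from one
  -- in `e`.
  have hinv : fderiv ℝ (e' ∘ e.symm) (e (γ s)) (fderiv ℝ (e ∘ e'.symm) (e' (γ s)) w) = w := by
    have h3 : HasFDerivAt ((e' ∘ e.symm) ∘ (e ∘ e'.symm)) _ (e' (γ s)) :=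
      HasFDerivAt.comp (g := e' ∘ e.symm) (f := e ∘ e'.symm) (e' (γ s))
      (g' := fderiv ℝ (e' ∘ e.symm) (e (γ s)))
      (by simpa [e'.left_inv hx'] using (hφ.differentiableAt (by norm_num)).hasFDerivAt)
      (hψ.differentiableAt (by norm_num)).hasFDerivAt
    have h4 : ((e' ∘ e.symm) ∘ (e ∘ e'.symm)) =ᶠ[𝓝 (e' (γ s))] id := by
      filter_upwards [e'.open_target.mem_nhds (e'.map_source hx'),
        (e'.continuousAt_symm (e'.map_source hx')).eventually
          (by rw [e'.left_inv hx']; exact e.open_source.mem_nhds hx)] with y hy hy'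
      simp [e.left_inv hy', e'.right_inv hy]
    have h5 := h3.unique ((hasFDerivAt_id _).congr_of_eventuallyEq h4)
    exact congrArg (fun T : E4 →L[ℝ] E4 => T w) h5
  have key := geodesicForm_comp (G := inChart S.g e) (G' := inChart S.g e') (y := e (γ s))
    (φ := e' ∘ e.symm) (by rw [hφs]; exact S.differentiableAt_inChart he' (e'.map_source hx')) hφ
    (S.inChart_change he he' hx hx') (S.differentiableAt_inChart he (e.map_source hx))
    (S.inChart_symm e' _) (deriv (e ∘ γ) s) (deriv (deriv (e ∘ γ)) s)
    (fderiv ℝ (e ∘ e'.symm) (e' (γ s)) w)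
  rw [h.2, hinv, hφs] at key
  exact key.symm

theorem Spacetime.isGeodesicOn_of_forall_exists {γ : ℝ → M} {J : Set ℝ}
    (h : ∀ s ∈ J, ContinuousAt γ s ∧ ∃ e ∈ atlas E4 M, γ s ∈ e.source ∧ S.GeodesicAt e γ s) :
    S.IsGeodesicOn γ J := by
  refine ⟨fun s hs => (h s hs).1.continuousWithinAt, fun e' he' s hs hs' => ?_⟩
  obtain ⟨hc, e, he, hse, hg⟩ := h s hs
  exact hg.change he he' hc hse hs'

end ChartChange

/-! ### The geodesic spray -/

section Acceleration

set_option maxSynthPendingDepth 3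

variable {E : Type*} [NormedAddCommGroup E] [NormedSpace ℝ E]

/-- The acceleration of a geodesic with position `y` and velocity `v`, for the metric components
`G`. -/
noncomputable def acceleration (G : E → E →L[ℝ] E →L[ℝ] ℝ) (y v : E) : E :=
  (G y).inverse ((1 / 2 : ℝ) • ((fderiv ℝ G y).flip v).flip v - fderiv ℝ G y v v)

/-- The geodesic spray of the metric components `G`. -/
noncomputable def spray (G : E → E →L[ℝ] E →L[ℝ] ℝ) (w : E × E) : E × E :=
  (w.2, acceleration G w.1 w.2)

/-- Inverting the metric raises the index and puts the equation in normal form. -/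
theorem geodesicForm_eq_zero_iff {G : E → E →L[ℝ] E →L[ℝ] ℝ} {y : E} (h : (G y).IsInvertible)
    (v a : E) : (∀ w, geodesicForm G y v a w = 0) ↔ a = acceleration G y v := by
  have h1 : (∀ w, geodesicForm G y v a w = 0) ↔
      G y a = (1 / 2 : ℝ) • ((fderiv ℝ G y).flip v).flip v - fderiv ℝ G y v v := by
    rw [ContinuousLinearMap.ext_iff]
    refine forall_congr' fun w => ?_
    simp only [geodesicForm, _root_.sub_apply, _root_.smul_apply,
      ContinuousLinearMap.flip_apply, smul_eq_mul]
    constructor <;> intro h <;> linarith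
  rw [h1, acceleration]
  obtain ⟨e, he⟩ := h
  rw [← he, ContinuousLinearMap.inverse_equiv]
  exact e.eq_symm_apply.symm

theorem continuousOn_acceleration [CompleteSpace E] {G : E → E →L[ℝ] E →L[ℝ] ℝ} {U : Set E}
    (hU : IsOpen U) (hG : ContDiffOn ℝ 1 G U) (h : ∀ y ∈ U, (G y).IsInvertible) :
    ContinuousOn (fun w : E × E => acceleration G w.1 w.2) (U ×ˢ univ) := by
  have hd : ContinuousOn (fderiv ℝ G) U := hG.continuousOn_fderiv_of_isOpen hU le_rfl
  have hfst : MapsTo (Prod.fst : E × E → E) (U ×ˢ univ) U := fun w hw => hw.1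
  have h1 : ContinuousOn (fun w : E × E => (G w.1).inverse) (U ×ˢ univ) := by
    have : ContinuousOn (fun y => (G y).inverse) U := fun y hy =>
      ((h y hy).contDiffAt_map_inverse (n := 0)).continuousAt.comp_continuousWithinAt
        (hG.continuousOn y hy)
    exact this.comp continuousOn_fst hfst
  have h2 : ContinuousOn (fun w : E × E => fderiv ℝ G w.1) (U ×ˢ univ) :=
    hd.comp continuousOn_fst hfst
  have h3 : ContinuousOn (fun w : E × E => ((fderiv ℝ G w.1).flip w.2).flip w.2) (U ×ˢ univ) := by
    have e1 : ContinuousOn (fun w : E × E => (fderiv ℝ G w.1).flip w.2) (U ×ˢ univ) :=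
      ((ContinuousLinearMap.flipₗᵢ ℝ E E (E →L[ℝ] ℝ)).continuous.comp_continuousOn h2).clm_apply
        continuousOn_snd
    exact ((ContinuousLinearMap.flipₗᵢ ℝ E E ℝ).continuous.comp_continuousOn e1).clm_apply
        continuousOn_snd
  exact h1.clm_apply ((h3.const_smul (1 / 2 : ℝ)).sub
    ((h2.clm_apply continuousOn_snd).clm_apply continuousOn_snd))

theorem norm_acceleration_le (G : E → E →L[ℝ] E →L[ℝ] ℝ) (y v : E) :
    ‖acceleration G y v‖ ≤ 2 * ‖(G y).inverse‖ * ‖fderiv ℝ G y‖ * ‖v‖ ^ 2 := by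
  have h1 : ‖((fderiv ℝ G y).flip v).flip v‖ ≤ ‖fderiv ℝ G y‖ * ‖v‖ * ‖v‖ := by
    refine (ContinuousLinearMap.le_opNorm _ v).trans ?_
    rw [ContinuousLinearMap.opNorm_flip]
    gcongr
    refine (ContinuousLinearMap.le_opNorm _ v).trans ?_
    rw [ContinuousLinearMap.opNorm_flip]
  have h2 : ‖fderiv ℝ G y v v‖ ≤ ‖fderiv ℝ G y‖ * ‖v‖ * ‖v‖ :=
    ContinuousLinearMap.le_opNorm₂ _ v v
  refine (ContinuousLinearMap.le_opNorm _ _).trans ?_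
  rw [mul_comm (2 : ℝ), mul_assoc, mul_assoc]
  gcongr
  refine (norm_sub_le _ _).trans ?_
  rw [norm_smul]
  norm_num
  nlinarith [norm_nonneg (fderiv ℝ G y), norm_nonneg v,
    mul_nonneg (mul_nonneg (norm_nonneg (fderiv ℝ G y)) (norm_nonneg v)) (norm_nonneg v)]

/-- The quadratic growth in `v` is what the logarithmic derivative estimate in `exists_leaving_nhds`
requires. -/
theorem exists_norm_acceleration_le [CompleteSpace E] {G : E → E →L[ℝ] E →L[ℝ] ℝ} {U : Set E}
    (hU : IsOpen U) (hG : ContDiffOn ℝ 1 G U) (h : ∀ y ∈ U, (G y).IsInvertible) {q : E}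
    (hq : q ∈ U) : ∃ K ≥ 0, ∀ᶠ y in 𝓝 q, ∀ v, ‖acceleration G y v‖ ≤ K * ‖v‖ ^ 2 := by
  have hd : ContinuousAt (fun y => 2 * ‖(G y).inverse‖ * ‖fderiv ℝ G y‖) q := by
    have h1 : ContinuousAt (fderiv ℝ G) q :=
      (hG.continuousOn_fderiv_of_isOpen hU le_rfl).continuousAt (hU.mem_nhds hq)
    have h2 : ContinuousAt (fun y => (G y).inverse) q :=
      ((h q hq).contDiffAt_map_inverse (n := 0)).continuousAt.comp
        (hG.continuousOn.continuousAt (hU.mem_nhds hq))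
    exact (h2.norm.const_mul 2).mul h1.norm
  refine ⟨2 * ‖(G q).inverse‖ * ‖fderiv ℝ G q‖ + 1, by positivity, ?_⟩
  filter_upwards [hd.eventually_lt_const (lt_add_one _)] with y hy v
  exact (norm_acceleration_le G y v).trans (by gcongr)

end Acceleration

/-! ### Geodesics as integral curves in the tangent bundle -/

section PhaseSpace

variable {M : Type*} [TopologicalSpace M] [ChartedSpace E4 M] [IsManifold I4 ∞ M]

theorem mfderiv_symm_mfderiv {e : OpenPartialHomeomorph M E4} (he : e ∈ atlas E4 M) {x : M}
    (hx : x ∈ e.source) (v : TangentSpace I4 x) :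
    (mfderiv I4 I4 e.symm (e x) (mfderiv I4 I4 e x v : E4) : E4) = v := by
  have hev : e.symm ∘ e =ᶠ[𝓝 x] id := by
    filter_upwards [e.open_source.mem_nhds hx] with y hy
    exact e.left_inv hy
  have h := mfderiv_comp x (mdifferentiableAt_symm_of_mem_atlas he (e.map_source hx))
    (mdifferentiableAt_of_mem_atlas he hx)
  have h2 : mfderiv I4 I4 (e.symm ∘ e) x = _ := hev.mfderiv_eq
  have h3 : (mfderiv I4 I4 (e.symm ∘ e) x v : E4) = (mfderiv I4 I4 (id : M → M) x v : E4) := by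
    rw [h2]; rfl
  rw [h] at h3
  rw [mfderiv_id] at h3
  exact h3

/-- A one-sided inverse of an endomorphism of a finite-dimensional space is two-sided. -/
theorem mfderiv_mfderiv_symm {e : OpenPartialHomeomorph M E4} (he : e ∈ atlas E4 M) {x : M}
    (hx : x ∈ e.source) (v : E4) :
    (mfderiv I4 I4 e x (mfderiv I4 I4 e.symm (e x) v : E4) : E4) = v := by
  have hsurj : Function.Surjective (mfderiv I4 I4 e x : E4 →L[ℝ] E4) := by
    have hinj : Function.Injective (mfderiv I4 I4 e x : E4 →L[ℝ] E4) :=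
      Function.LeftInverse.injective (g := (mfderiv I4 I4 e.symm (e x) : E4 →L[ℝ] E4))
        fun v => mfderiv_symm_mfderiv he hx v
    exact (LinearMap.injective_iff_surjective (f := (show E4 →L[ℝ] E4 from mfderiv I4 I4 e x).toLinearMap)).1
      hinj
  obtain ⟨u, rfl⟩ := hsurj v
  exact congrArg (mfderiv I4 I4 e x : E4 →L[ℝ] E4) (mfderiv_symm_mfderiv he hx u)

variable (S : Spacetime M)

theorem Spacetime.g_eq_inChart {e : OpenPartialHomeomorph M E4} (he : e ∈ atlas E4 M) {x : M}
    (hx : x ∈ e.source) (u v : TangentSpace I4 x) :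
    S.g x u v = inChart S.g e (e x) (mfderiv I4 I4 e x u) (mfderiv I4 I4 e x v) := by
  refine ((S.inChart_apply e hx _ _).trans ?_).symm
  exact congrArg₂ (fun a b : E4 => (S.g x : E4 →L[ℝ] E4 →L[ℝ] ℝ) a b)
    (mfderiv_symm_mfderiv he hx u) (mfderiv_symm_mfderiv he hx v)

theorem Spacetime.eq_zero_of_g_eq_zero {x : M} {v : TangentSpace I4 x}
    (h : ∀ w, S.g x v w = 0) : v = 0 := by
  obtain ⟨b, hb⟩ := S.lorentzian x
  have hv := b.sum_repr v
  have h1 : ∀ j, b.repr v j = 0 := by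
    intro j
    have h2 := h (b j)
    rw [← hv] at h2
    simp only [map_sum, map_smul, _root_.sum_apply, _root_.smul_apply, hb,
      smul_eq_mul, mul_ite, mul_zero, Finset.sum_ite_eq', Finset.mem_univ, if_true] at h2
    split_ifs at h2 with hj
    · simpa using h2
    · simpa using h2
  rw [← hv]
  simp [h1]

/-- Nondegeneracy gives injectivity; `E4` and its dual have equal dimension. -/
theorem Spacetime.isInvertible_inChart {e : OpenPartialHomeomorph M E4} (he : e ∈ atlas E4 M)
    {y : E4} (hy : y ∈ e.target) : (inChart S.g e y).IsInvertible := by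
  obtain ⟨x, hx, rfl⟩ : ∃ z ∈ e.source, e z = y := ⟨e.symm y, e.map_target hy, e.right_inv hy⟩
  have hinj : Function.Injective (inChart S.g e (e x)) := by
    rw [injective_iff_map_eq_zero]
    intro a ha
    have h1 : (mfderiv I4 I4 e.symm (e x) a : E4) = 0 := by
      refine S.eq_zero_of_g_eq_zero (x := x) fun w => ?_
      have h2 : inChart S.g e (e x) a (mfderiv I4 I4 e x w) = 0 := by rw [ha]; rfl
      refine Eq.trans ?_ ((S.inChart_apply e hx _ _).symm.trans h2)
      exact congrArg (fun b : E4 => (S.g x : E4 →L[ℝ] E4 →L[ℝ] ℝ)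
        (mfderiv I4 I4 e.symm (e x) a) b) (mfderiv_symm_mfderiv he hx w).symm
    rw [← mfderiv_mfderiv_symm he hx a, h1]
    exact map_zero (mfderiv I4 I4 e x : E4 →L[ℝ] E4)
  have hdim : Module.finrank ℝ E4 = Module.finrank ℝ (E4 →L[ℝ] ℝ) := by
    rw [LinearMap.toContinuousLinearMap.symm.finrank_eq (M := E4 →L[ℝ] ℝ) (N := E4 →ₗ[ℝ] ℝ)]
    exact (Subspace.dual_finrank_eq (K := ℝ) (V := E4)).symm
  let L := (LinearEquiv.ofInjectiveOfFinrankEq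
    ((inChart S.g e (e x) : E4 →L[ℝ] (E4 →L[ℝ] ℝ)) : E4 →ₗ[ℝ] (E4 →L[ℝ] ℝ)) hinj hdim)
  exact ⟨L.toContinuousLinearEquiv, by ext; rfl⟩

theorem Spacetime.continuousOn_spray {e : OpenPartialHomeomorph M E4} (he : e ∈ atlas E4 M) :
    ContinuousOn (spray (inChart S.g e)) (e.target ×ˢ univ) :=
  continuousOn_snd.prodMk (continuousOn_acceleration e.open_target (S.contDiff e he)
    fun _ hy => S.isInvertible_inChart he hy)

variable {S}

theorem Spacetime.geodesicAt_iff {e : OpenPartialHomeomorph M E4} (he : e ∈ atlas E4 M)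
    {γ : ℝ → M} {s : ℝ} (hs : γ s ∈ e.source) : S.GeodesicAt e γ s ↔ ContDiffAt ℝ 2 (e ∘ γ) s ∧
      deriv (deriv (e ∘ γ)) s = acceleration (inChart S.g e) (e (γ s)) (deriv (e ∘ γ) s) := by
  rw [Spacetime.GeodesicAt, geodesicForm_eq_zero_iff (S.isInvertible_inChart he (e.map_source hs))]

/-- Position and velocity of a curve in a chart. -/
noncomputable def phase (e : OpenPartialHomeomorph M E4) (γ : ℝ → M) (s : ℝ) : E4 × E4 :=
  (e (γ s), deriv (e ∘ γ) s)

theorem Spacetime.GeodesicAt.hasDerivAt_phase {e : OpenPartialHomeomorph M E4}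
    (he : e ∈ atlas E4 M) {γ : ℝ → M} {s : ℝ} (hs : γ s ∈ e.source) (h : S.GeodesicAt e γ s) :
    HasDerivAt (phase e γ) (spray (inChart S.g e) (phase e γ s)) s := by
  rw [geodesicAt_iff he hs] at h
  have h1 : HasDerivAt (e ∘ γ) (deriv (e ∘ γ) s) s :=
    (h.1.differentiableAt (by norm_num)).hasDerivAt
  have h2 : HasDerivAt (deriv (e ∘ γ)) (deriv (deriv (e ∘ γ)) s) s :=
    ((contDiffAt_deriv_curve h.1).differentiableAt (by norm_num)).hasDerivAt
  rw [h.2] at h2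
  exact h1.prodMk h2

/-- Bootstrap: along a differentiable solution the acceleration is continuous, so the velocity is
`C¹` and the position `C²`. -/
theorem Spacetime.isGeodesicOn_of_hasDerivAt {e : OpenPartialHomeomorph M E4}
    (he : e ∈ atlas E4 M) {α : ℝ → E4 × E4} {J : Set ℝ} (hJ : IsOpen J)
    (hα : ∀ s ∈ J, HasDerivAt α (spray (inChart S.g e) (α s)) s ∧ (α s).1 ∈ e.target) :
    S.IsGeodesicOn (fun s => e.symm (α s).1) J ∧
      ∀ s ∈ J, phase e (fun s => e.symm (α s).1) s = α s := by
  have h1 : ∀ s ∈ J, HasDerivAt (fun s => (α s).1) (α s).2 s := fun s hs => (hα s hs).1.fst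
  have h2 : ∀ s ∈ J, HasDerivAt (fun s => (α s).2)
      (acceleration (inChart S.g e) (α s).1 (α s).2) s := fun s hs => (hα s hs).1.snd
  have hcα : ContinuousOn α J := fun s hs => (hα s hs).1.continuousAt.continuousWithinAt
  have hc2 : ContDiffOn ℝ 1 (fun s => (α s).2) J := by
    rw [show (1 : WithTop ℕ∞) = 0 + 1 by norm_num, contDiffOn_succ_iff_deriv_of_isOpen hJ]
    refine ⟨fun s hs => (h2 s hs).differentiableAt.differentiableWithinAt, by simp, ?_⟩
    rw [contDiffOn_zero]
    have : ContinuousOn (fun s => acceleration (inChart S.g e) (α s).1 (α s).2) J :=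
      (continuousOn_acceleration e.open_target (S.contDiff e he)
        fun _ hy => S.isInvertible_inChart he hy).comp hcα fun s hs => ⟨(hα s hs).2, mem_univ _⟩
    exact this.congr fun s hs => (h2 s hs).deriv
  have hc1 : ContDiffOn ℝ 2 (fun s => (α s).1) J := by
    rw [show (2 : WithTop ℕ∞) = 1 + 1 by norm_num, contDiffOn_succ_iff_deriv_of_isOpen hJ]
    exact ⟨fun s hs => (h1 s hs).differentiableAt.differentiableWithinAt, by simp,
      hc2.congr fun s hs => (h1 s hs).deriv⟩
  have hev : ∀ s ∈ J, e ∘ (fun s => e.symm (α s).1) =ᶠ[𝓝 s] fun s => (α s).1 := by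
    intro s hs
    filter_upwards [hJ.mem_nhds hs] with r hr
    exact e.right_inv (hα r hr).2
  have hd : ∀ s ∈ J, deriv (e ∘ fun s => e.symm (α s).1) s = (α s).2 := fun s hs => by
    rw [(hev s hs).deriv_eq]; exact (h1 s hs).deriv
  refine ⟨isGeodesicOn_of_forall_exists fun s hs => ⟨?_, e, he, e.map_target (hα s hs).2, ?_⟩,
    fun s hs => Prod.ext (e.right_inv (hα s hs).2) (hd s hs)⟩
  · exact (e.continuousAt_symm (hα s hs).2).comp (f := fun s => (α s).1) (h1 s hs).continuousAt
  · rw [geodesicAt_iff he (e.map_target (hα s hs).2)]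
    refine ⟨(hc1.contDiffAt (hJ.mem_nhds hs)).congr_of_eventuallyEq (hev s hs), ?_⟩
    have : deriv (e ∘ fun s => e.symm (α s).1) =ᶠ[𝓝 s] fun s => (α s).2 := by
      filter_upwards [hJ.mem_nhds hs] with r hr using hd r hr
    rw [this.deriv_eq, (h2 s hs).deriv, hd s hs, e.right_inv (hα s hs).2]

/-- The chart of the tangent bundle induced by the preferred chart at `x₀`. -/
noncomputable def phaseChart (x₀ : M) : OpenPartialHomeomorph (TangentBundle I4 M) (E4 × E4) :=
  chartAt (ModelProd E4 E4) (⟨x₀, 0⟩ : TangentBundle I4 M)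

theorem mem_phaseChart_source {x₀ : M} {z : TangentBundle I4 M} :
    z ∈ (phaseChart x₀).source ↔ z.1 ∈ (chartAt E4 x₀).source :=
  TangentBundle.mem_chart_source_iff _ _

theorem mem_phaseChart_target {x₀ : M} {w : E4 × E4} :
    w ∈ (phaseChart x₀).target ↔ w.1 ∈ (chartAt E4 x₀).target :=
  TangentBundle.mem_chart_target_iff _ _

theorem phaseChart_apply {x₀ : M} {z : TangentBundle I4 M} (hz : z.1 ∈ (chartAt E4 x₀).source) :
    phaseChart x₀ z = (chartAt E4 x₀ z.1, mfderiv I4 I4 (chartAt E4 x₀) z.1 z.2) := by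
  have : IsManifold I4 1 M := IsManifold.of_le (n := ∞) (by exact_mod_cast le_top)
  have h := tangentMap_chart (I := I4) (p := (⟨x₀, 0⟩ : TangentBundle I4 M)) (q := z) hz
  have h2 := congrArg (Bundle.TotalSpace.toProd E4 E4) h
  rw [Equiv.apply_symm_apply] at h2
  exact h2.symm

theorem mdifferentiableAt_of_contDiffAt {e : OpenPartialHomeomorph M E4} (he : e ∈ atlas E4 M)
    {γ : ℝ → M} {s : ℝ} (hγ : ContinuousAt γ s) (hs : γ s ∈ e.source)
    (h : DifferentiableAt ℝ (e ∘ γ) s) : MDifferentiableAt 𝓘(ℝ, ℝ) I4 γ s := by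
  have hev : γ =ᶠ[𝓝 s] e.symm ∘ (e ∘ γ) := by
    filter_upwards [hγ (e.open_source.mem_nhds hs)] with r hr
    exact (e.left_inv hr).symm
  refine MDifferentiableAt.congr_of_eventuallyEq ?_ hev
  exact (mdifferentiableAt_symm_of_mem_atlas he (e.map_source hs)).comp s h.mdifferentiableAt

theorem mfderiv_velocity {e : OpenPartialHomeomorph M E4} (he : e ∈ atlas E4 M)
    {γ : ℝ → M} {s : ℝ} (hs : γ s ∈ e.source) (hγ : MDifferentiableAt 𝓘(ℝ, ℝ) I4 γ s) :
    (mfderiv I4 I4 e (γ s) (velocity γ s) : E4) = deriv (e ∘ γ) s := by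
  have h := mfderiv_comp s (mdifferentiableAt_of_mem_atlas he hs) hγ
  rw [← fderiv_apply_one_eq_deriv, ← mfderiv_eq_fderiv, h]
  rfl

theorem Spacetime.IsGeodesicOn.continuousAt {γ : ℝ → M} {J : Set ℝ} (h : S.IsGeodesicOn γ J)
    (hJ : IsOpen J) {s : ℝ} (hs : s ∈ J) : ContinuousAt γ s := h.1.continuousAt (hJ.mem_nhds hs)

theorem Spacetime.IsGeodesicOn.mdifferentiableAt {γ : ℝ → M} {J : Set ℝ}
    (h : S.IsGeodesicOn γ J) (hJ : IsOpen J) {s : ℝ} (hs : s ∈ J) :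
    MDifferentiableAt 𝓘(ℝ, ℝ) I4 γ s :=
  mdifferentiableAt_of_contDiffAt (chart_mem_atlas E4 (γ s)) (h.continuousAt hJ hs)
    (mem_chart_source E4 (γ s)) ((h.2 _ (chart_mem_atlas E4 (γ s)) s hs
      (mem_chart_source E4 (γ s))).1.differentiableAt (by norm_num))

theorem Spacetime.IsGeodesicOn.phaseChart_tangentLift {γ : ℝ → M} {J : Set ℝ}
    (h : S.IsGeodesicOn γ J) (hJ : IsOpen J) {s : ℝ} (hs : s ∈ J) {x₀ : M}
    (hx : γ s ∈ (chartAt E4 x₀).source) :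
    phaseChart x₀ (tangentLift γ s) = phase (chartAt E4 x₀) γ s := by
  rw [phaseChart_apply (z := tangentLift γ s) hx]
  exact Prod.ext rfl (mfderiv_velocity (chart_mem_atlas E4 x₀) hx (h.mdifferentiableAt hJ hs))

theorem Spacetime.IsGeodesicOn.continuousOn_tangentLift {γ : ℝ → M} {J : Set ℝ}
    (h : S.IsGeodesicOn γ J) (hJ : IsOpen J) : ContinuousOn (tangentLift γ) J := by
  intro s hs
  refine ContinuousAt.continuousWithinAt ?_
  have hx := mem_chart_source E4 (γ s)
  rw [(phaseChart (γ s)).continuousAt_iff_continuousAt_comp_left]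
  · have h1 := (Spacetime.GeodesicAt.hasDerivAt_phase (chart_mem_atlas E4 (γ s)) hx
      (h.2 _ (chart_mem_atlas E4 (γ s)) s hs hx)).continuousAt
    refine h1.congr ?_
    filter_upwards [hJ.mem_nhds hs, (h.continuousAt hJ hs).eventually
      ((chartAt E4 (γ s)).open_source.mem_nhds hx)] with r hr hr'
    exact (h.phaseChart_tangentLift hJ hr hr').symm
  · filter_upwards [(h.continuousAt hJ hs).eventually
      ((chartAt E4 (γ s)).open_source.mem_nhds hx)] with r hr
    exact mem_phaseChart_source.2 hr

end PhaseSpace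

/-! ### Maximal geodesics and the geodesic flow -/

variable {M : Type*} [TopologicalSpace M] [ChartedSpace E4 M] [IsManifold I4 ∞ M]
  {S : Spacetime M}

omit [IsManifold I4 ∞ M] in
theorem tangentLift_congr {γ γ' : ℝ → M} {s : ℝ} (h : γ =ᶠ[𝓝 s] γ') :
    tangentLift γ s = tangentLift γ' s := by
  have h1 : ∀ x : M, γ s = x → ∀ v : TangentSpace I4 x, (velocity γ s : E4) = (v : E4) →
      tangentLift γ s = ⟨x, v⟩ := by
    rintro _ rfl v hv
    exact congrArg (fun v => (⟨γ s, v⟩ : TangentBundle I4 M)) hv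
  refine h1 _ h.self_of_nhds _ ?_
  have : mfderiv 𝓘(ℝ, ℝ) I4 γ s = _ := h.mfderiv_eq
  rw [velocity, this]
  rfl

namespace Spacetime

theorem IsGeodesicOn.mono {γ : ℝ → M} {J J' : Set ℝ} (h : S.IsGeodesicOn γ J) (hJ : J' ⊆ J) :
    S.IsGeodesicOn γ J' := ⟨h.1.mono hJ, fun e he s hs => h.2 e he s (hJ hs)⟩

theorem IsGeodesicOn.of_local {γ : ℝ → M} {J : Set ℝ}
    (h : ∀ s ∈ J, ∃ γ' J', IsOpen J' ∧ s ∈ J' ∧ S.IsGeodesicOn γ' J' ∧ γ =ᶠ[𝓝 s] γ') :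
    S.IsGeodesicOn γ J := by
  refine isGeodesicOn_of_forall_exists fun s hs => ?_
  obtain ⟨γ', J', hJ', hs', hg, hev⟩ := h s hs
  have heq := hev.self_of_nhds
  refine ⟨(hg.continuousAt hJ' hs').congr hev.symm, chartAt E4 (γ s), chart_mem_atlas _ _,
    mem_chart_source _ _, ?_⟩
  have h1 := hg.2 _ (chart_mem_atlas E4 (γ s)) s hs' (by rw [← heq]; exact mem_chart_source _ _)
  have h2 : chartAt E4 (γ s) ∘ γ =ᶠ[𝓝 s] chartAt E4 (γ s) ∘ γ' := by
    filter_upwards [hev] with r hr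
    simp [hr]
  refine ⟨h1.1.congr_of_eventuallyEq h2, fun w => ?_⟩
  rw [h2.deriv_eq, h2.deriv.deriv_eq]
  have h3 := h1.2 w
  rw [← heq] at h3
  exact h3

theorem IsGeodesicOn.comp_affine {γ : ℝ → M} {J : Set ℝ} (h : S.IsGeodesicOn γ J) (hJ : IsOpen J)
    (c d : ℝ) : S.IsGeodesicOn (fun s => γ (c * s + d)) ((fun s => c * s + d) ⁻¹' J) := by
  have hca : Continuous fun s : ℝ => c * s + d := by fun_prop
  refine ⟨h.1.comp hca.continuousOn fun s hs => hs, fun e he s hs hse => ?_⟩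
  obtain ⟨h1, h2⟩ := h.2 e he (c * s + d) hs hse
  have hopen : ∀ᶠ r in 𝓝 s, c * r + d ∈ J ∧ γ (c * r + d) ∈ e.source :=
    hca.continuousAt.eventually (Eventually.and (hJ.mem_nhds hs) ((h.continuousAt hJ hs).eventually
      (e.open_source.mem_nhds hse)) : ∀ᶠ r in 𝓝 (c * s + d), r ∈ J ∧ γ r ∈ e.source)
  have hda : ∀ r : ℝ, HasDerivAt (fun s : ℝ => c * s + d) c r := fun r => by
    simpa using ((hasDerivAt_id r).const_mul c).add_const d
  have hd : deriv (e ∘ fun s => γ (c * s + d)) =ᶠ[𝓝 s]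
      fun r => c • deriv (e ∘ γ) (c * r + d) := by
    filter_upwards [hopen] with r hr
    exact (((h.2 e he _ hr.1 hr.2).1.differentiableAt (by norm_num)).hasDerivAt.scomp r
      (hda r)).deriv
  have hdd : deriv (deriv (e ∘ fun s => γ (c * s + d))) s =
      (c * c) • deriv (deriv (e ∘ γ)) (c * s + d) := by
    rw [hd.deriv_eq, mul_smul]
    exact ((((contDiffAt_deriv_curve h1).differentiableAt (by norm_num)).hasDerivAt.scomp s
      (hda s)).const_smul c).deriv
  refine ⟨h1.comp s (f := fun s => c * s + d) (by fun_prop), fun w => ?_⟩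
  rw [hdd, hd.self_of_nhds]
  simp only [map_smul, _root_.smul_apply, smul_eq_mul]
  linear_combination (c * c) * h2 w

theorem IsGeodesicOn.tangentLift_comp_affine {γ : ℝ → M} {J : Set ℝ} (h : S.IsGeodesicOn γ J)
    (hJ : IsOpen J) (c d : ℝ) {s : ℝ} (hs : c * s + d ∈ J) :
    tangentLift (fun s => γ (c * s + d)) s =
      ⟨γ (c * s + d), c • velocity γ (c * s + d)⟩ := by
  have hda : HasDerivAt (fun s : ℝ => c * s + d) c s := by
    simpa using ((hasDerivAt_id s).const_mul c).add_const d
  have h1 := mfderiv_comp s (h.mdifferentiableAt hJ hs) hda.differentiableAt.mdifferentiableAt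
  have h2 : velocity (fun s => γ (c * s + d)) s = c • velocity γ (c * s + d) := by
    rw [velocity]
    refine (congrArg (fun T : ℝ →L[ℝ] E4 => T 1) h1).trans ?_
    have h3 : mfderiv 𝓘(ℝ, ℝ) 𝓘(ℝ, ℝ) (fun s : ℝ => c * s + d) s (1 : ℝ) = c := by
      rw [mfderiv_eq_fderiv]
      exact hda.deriv
    have h4 : c = c • (1 : ℝ) := by simp
    refine Eq.trans (congrArg (mfderiv 𝓘(ℝ, ℝ) I4 γ (c * s + d) : ℝ →L[ℝ] E4) (h3.trans h4)) ?_
    exact map_smul (mfderiv 𝓘(ℝ, ℝ) I4 γ (c * s + d) : ℝ →L[ℝ] E4) c 1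
  exact congrArg (fun v => (⟨γ (c * s + d), v⟩ : TangentBundle I4 M)) h2

variable (S) in
/-- The domain of the maximal geodesic with initial position and velocity `z`. -/
def maxDomain (z : TangentBundle I4 M) : Set ℝ :=
  {s | ∃ (γ : ℝ → M) (J : Set ℝ), IsOpen J ∧ J.OrdConnected ∧ (0 : ℝ) ∈ J ∧ s ∈ J ∧
    S.IsGeodesicOn γ J ∧ tangentLift γ 0 = z}

open Classical in
variable (S) in
/-- The maximal geodesic with initial position and velocity `z`. -/
noncomputable def maxGeodesic (z : TangentBundle I4 M) (s : ℝ) : M :=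
  if h : s ∈ S.maxDomain z then h.choose s else z.1

variable (S) in
/-- The geodesic flow. -/
noncomputable def flow (z : TangentBundle I4 M) (s : ℝ) : TangentBundle I4 M :=
  tangentLift (S.maxGeodesic z) s

/-- `maxGeodesic` chooses a geodesic separately at each parameter; uniqueness makes the choice
immaterial. -/
theorem maxGeodesic_eq (hgeo : S.HasUniqueGeodesics) {γ : ℝ → M} {J : Set ℝ} (hJ : IsOpen J)
    (hJc : J.OrdConnected) (h0 : (0 : ℝ) ∈ J) (hγ : S.IsGeodesicOn γ J) {s : ℝ} (hs : s ∈ J) :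
    s ∈ S.maxDomain (tangentLift γ 0) ∧ S.maxGeodesic (tangentLift γ 0) s = γ s := by
  have h : s ∈ S.maxDomain (tangentLift γ 0) := ⟨γ, J, hJ, hJc, h0, hs, hγ, rfl⟩
  refine ⟨h, ?_⟩
  rw [maxGeodesic, dif_pos h]
  obtain ⟨J', hJ', hJc', h0', hs', hγ', hz'⟩ := h.choose_spec
  exact hgeo.2 (J' ∩ J) _ _ (hJ'.inter hJ) (hJc'.inter hJc) ⟨h0', h0⟩ (hγ'.mono inter_subset_left)
    (hγ.mono inter_subset_right) hz' ⟨hs', hs⟩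

theorem flow_eq (hgeo : S.HasUniqueGeodesics) {γ : ℝ → M} {J : Set ℝ} (hJ : IsOpen J)
    (hJc : J.OrdConnected) (h0 : (0 : ℝ) ∈ J) (hγ : S.IsGeodesicOn γ J) {s : ℝ} (hs : s ∈ J) :
    S.flow (tangentLift γ 0) s = tangentLift γ s := by
  refine tangentLift_congr ?_
  filter_upwards [hJ.mem_nhds hs] with r hr
  exact (maxGeodesic_eq hgeo hJ hJc h0 hγ hr).2

theorem isOpen_maxDomain (z : TangentBundle I4 M) : IsOpen (S.maxDomain z) := by
  rw [isOpen_iff_mem_nhds]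
  rintro s ⟨γ, J, hJ, hJc, h0, hs, hγ, hz⟩
  filter_upwards [hJ.mem_nhds hs] with r hr
  exact ⟨γ, J, hJ, hJc, h0, hr, hγ, hz⟩

theorem ordConnected_maxDomain (z : TangentBundle I4 M) : (S.maxDomain z).OrdConnected := by
  refine ⟨?_⟩
  rintro s ⟨γ, J, hJ, hJc, h0, hs, hγ, hz⟩ t ⟨γ', J', hJ', hJc', h0', ht', hγ', hz'⟩ r hr
  rcases le_total r 0 with h | h
  · exact ⟨γ, J, hJ, hJc, h0, hJc.out hs h0 ⟨hr.1, h⟩, hγ, hz⟩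
  · exact ⟨γ', J', hJ', hJc', h0', hJc'.out h0' ht' ⟨h, hr.2⟩, hγ', hz'⟩

section Flow

variable (hgeo : S.HasUniqueGeodesics)
include hgeo

theorem zero_mem_maxDomain (z : TangentBundle I4 M) : (0 : ℝ) ∈ S.maxDomain z := by
  obtain ⟨ε, hε, γ, hγ, hz⟩ := hgeo.1 z
  exact ⟨γ, _, isOpen_Ioo, ordConnected_Ioo, by simpa using hε, by simpa using hε, hγ, hz⟩

theorem isGeodesicOn_maxGeodesic (z : TangentBundle I4 M) :
    S.IsGeodesicOn (S.maxGeodesic z) (S.maxDomain z) := by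
  refine .of_local fun s hs => ?_
  obtain ⟨γ, J, hJ, hJc, h0, hs, hγ, rfl⟩ := hs
  refine ⟨γ, J, hJ, hs, hγ, ?_⟩
  filter_upwards [hJ.mem_nhds hs] with r hr
  exact (maxGeodesic_eq hgeo hJ hJc h0 hγ hr).2

theorem flow_zero (z : TangentBundle I4 M) : S.flow z 0 = z := by
  obtain ⟨γ, J, hJ, hJc, h0, hs, hγ, rfl⟩ := zero_mem_maxDomain hgeo z
  exact flow_eq hgeo hJ hJc h0 hγ h0

theorem maxGeodesic_zero (z : TangentBundle I4 M) : S.maxGeodesic z 0 = z.1 :=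
  congrArg Bundle.TotalSpace.proj (flow_zero hgeo z)

/-- The geodesic translated by `s` starts at `S.flow z s`, so uniqueness identifies it with the
maximal one from there. -/
theorem flow_add_of_mem {z : TangentBundle I4 M} {s h : ℝ} (hs : s ∈ S.maxDomain z)
    (hsh : s + h ∈ S.maxDomain z) :
    h ∈ S.maxDomain (S.flow z s) ∧ S.flow (S.flow z s) h = S.flow z (s + h) := by
  have hg := isGeodesicOn_maxGeodesic hgeo z
  have hJ := S.isOpen_maxDomain z
  have h1 := hg.comp_affine hJ 1 s
  have hmem : ∀ r, r ∈ (fun r => 1 * r + s) ⁻¹' S.maxDomain z ↔ s + r ∈ S.maxDomain z := fun r => by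
    simp [add_comm]
  have hlift : ∀ r, s + r ∈ S.maxDomain z →
      tangentLift (fun r => S.maxGeodesic z (1 * r + s)) r = S.flow z (s + r) := by
    intro r hr
    rw [hg.tangentLift_comp_affine hJ 1 s (by simpa [add_comm] using hr), one_smul, one_mul,
      add_comm]
    rfl
  have hl0 := hlift 0 (by simpa using hs)
  rw [add_zero] at hl0
  have hop : IsOpen ((fun r => 1 * r + s) ⁻¹' S.maxDomain z) := hJ.preimage (by fun_prop)
  have hoc : ((fun r => 1 * r + s) ⁻¹' S.maxDomain z).OrdConnected := by
    refine (ordConnected_maxDomain z).preimage_mono fun a b hab => ?_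
    simpa using hab
  have h0 := (hmem 0).2 (by simpa using hs)
  rw [← hl0]
  exact ⟨(maxGeodesic_eq hgeo hop hoc h0 h1 ((hmem h).2 hsh)).1,
    (flow_eq hgeo hop hoc h0 h1 ((hmem h).2 hsh)).trans (hlift h hsh)⟩

/-- This is the continuation criterion. From `S.flow z s` both `-s` and `h` are reachable; rebasing
at time `-s` returns to `z` and turns `h` into `s + h`. -/
theorem flow_add {z : TangentBundle I4 M} {s h : ℝ} (hs : s ∈ S.maxDomain z)
    (hh : h ∈ S.maxDomain (S.flow z s)) :
    s + h ∈ S.maxDomain z ∧ S.flow (S.flow z s) h = S.flow z (s + h) := by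
  have h1 : s + -s ∈ S.maxDomain z := by simpa using zero_mem_maxDomain hgeo z
  obtain ⟨h2, h3⟩ := flow_add_of_mem hgeo hs h1
  have h4 := flow_add_of_mem hgeo h2 (h := s + h) (by simpa using hh)
  rw [h3, add_neg_cancel, flow_zero hgeo] at h4
  exact ⟨h4.1, (flow_add_of_mem hgeo hs h4.1).2⟩

/-- Reversing the velocity reduces statements about the past end to the future end. -/
theorem maxDomain_neg {z : TangentBundle I4 M} {s : ℝ} (hs : s ∈ S.maxDomain z) :
    -s ∈ S.maxDomain ⟨z.1, -z.2⟩ ∧ S.maxGeodesic ⟨z.1, -z.2⟩ (-s) = S.maxGeodesic z s := by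
  have hg := isGeodesicOn_maxGeodesic hgeo z
  have hJ := S.isOpen_maxDomain z
  have h1 := hg.comp_affine hJ (-1) 0
  have hop : IsOpen ((fun r => (-1 : ℝ) * r + 0) ⁻¹' S.maxDomain z) := hJ.preimage (by fun_prop)
  have hoc : ((fun r => (-1 : ℝ) * r + 0) ⁻¹' S.maxDomain z).OrdConnected := by
    refine (ordConnected_maxDomain z).preimage_anti fun a b hab => ?_
    simpa using hab
  have h0 := zero_mem_maxDomain hgeo z
  have hl : tangentLift (fun r => S.maxGeodesic z (-1 * r + 0)) 0 = ⟨z.1, -z.2⟩ := by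
    rw [hg.tangentLift_comp_affine hJ (-1) 0 (by simpa using h0)]
    have h2 : -1 * (0 : ℝ) + 0 = 0 := by simp
    rw [h2, neg_one_smul]
    have h3 : ∀ z' : TangentBundle I4 M, z' = z → (⟨z'.1, -z'.2⟩ : TangentBundle I4 M) =
      ⟨z.1, -z.2⟩ := by rintro _ rfl; rfl
    exact h3 (S.flow z 0) (flow_zero hgeo z)
  have h4 := maxGeodesic_eq hgeo hop hoc (by simpa using h0) h1 (s := -s) (by simpa using hs)
  rw [hl] at h4
  exact ⟨h4.1, by simpa using h4.2⟩

/-- Identifies with the flow any solution in a chart, whether from Peano's theorem or as an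
ultrafilter limit. -/
theorem phaseChart_symm_eq_flow {x₀ : M} {ε : ℝ} (hε : 0 < ε) {α : ℝ → E4 × E4}
    (hα : ∀ s ∈ Ioo (-ε) ε, HasDerivAt α (spray (inChart S.g (chartAt E4 x₀)) (α s)) s ∧
      α s ∈ (phaseChart x₀).target) {z : TangentBundle I4 M} (hz : z ∈ (phaseChart x₀).source)
    (h0 : α 0 = phaseChart x₀ z) {s : ℝ} (hs : s ∈ Ioo (-ε) ε) :
    s ∈ S.maxDomain z ∧ S.flow z s = (phaseChart x₀).symm (α s) := by
  obtain ⟨hg, hph⟩ := isGeodesicOn_of_hasDerivAt (S := S) (chart_mem_atlas E4 x₀) isOpen_Ioo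
    (fun s hs => ⟨(hα s hs).1, mem_phaseChart_target.1 (hα s hs).2⟩)
  have hlift : ∀ s ∈ Ioo (-ε) ε, tangentLift (fun s => (chartAt E4 x₀).symm (α s).1) s =
      (phaseChart x₀).symm (α s) := by
    intro s hs
    have h1 : (chartAt E4 x₀).symm (α s).1 ∈ (chartAt E4 x₀).source :=
      (chartAt E4 x₀).map_target (mem_phaseChart_target.1 (hα s hs).2)
    have h2 := hg.phaseChart_tangentLift isOpen_Ioo hs h1
    rw [hph s hs] at h2
    rw [← h2, (phaseChart x₀).left_inv]
    exact mem_phaseChart_source.2 h1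
  have h00 : (0 : ℝ) ∈ Ioo (-ε) ε := by simpa using hε
  have h3 : tangentLift (fun s => (chartAt E4 x₀).symm (α s).1) 0 = z := by
    rw [hlift 0 h00, h0, (phaseChart x₀).left_inv hz]
  rw [← hlift s hs, ← h3]
  exact ⟨(maxGeodesic_eq hgeo isOpen_Ioo ordConnected_Ioo h00 hg hs).1,
    flow_eq hgeo isOpen_Ioo ordConnected_Ioo h00 hg hs⟩

/-- Near each point of the tangent bundle, the geodesic flow exists for a uniform time, stays in a
given neighbourhood, and is continuous. -/
theorem exists_uniform_flow (z₀ : TangentBundle I4 M) {O : Set (TangentBundle I4 M)}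
    (hO : O ∈ 𝓝 z₀) : ∃ ε > 0, ∃ W ∈ 𝓝 z₀, IsOpen W ∧ ∀ z ∈ W, ∀ h ∈ Ioo (-ε) ε,
      h ∈ S.maxDomain z ∧ S.flow z h ∈ O ∧ ContinuousAt (fun z => S.flow z h) z := by
  set x₀ := z₀.1
  set Ψ := phaseChart (M := M) x₀ with hΨ
  set f := spray (inChart S.g (chartAt E4 x₀)) with hf
  have hz₀ : z₀ ∈ Ψ.source := mem_phaseChart_source.2 (mem_chart_source E4 x₀)
  have hO' : Ψ.target ∩ Ψ.symm ⁻¹' O ∈ 𝓝 (Ψ z₀) :=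
    inter_mem (Ψ.open_target.mem_nhds (Ψ.map_source hz₀))
      ((Ψ.continuousAt_symm (Ψ.map_source hz₀)) (by rwa [Ψ.left_inv hz₀]))
  obtain ⟨r', hr', hball⟩ := Metric.nhds_basis_closedBall.mem_iff.1 hO'
  lift r' to NNReal using hr'.le with r
  have hcf : ContinuousOn f (Metric.closedBall (Ψ z₀) r) :=
    (S.continuousOn_spray (chart_mem_atlas E4 x₀)).mono fun w hw =>
      ⟨mem_phaseChart_target.1 (hball hw).1, mem_univ _⟩
  have hK : IsCompact (Metric.closedBall (Ψ z₀) (r : ℝ)) := isCompact_closedBall _ _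
  obtain ⟨L', hL'⟩ := hK.bddAbove_image hcf.norm
  have hL : ∀ w ∈ Metric.closedBall (Ψ z₀) (r : ℝ), ‖f w‖ ≤ (L'.toNNReal : NNReal) := fun w hw =>
    (hL' (mem_image_of_mem _ hw)).trans (Real.le_coe_toNNReal L')
  set L := L'.toNNReal
  -- At speed at most `L + 1`, a solution from the half ball needs at least this time to leave the
  -- ball.
  have hε : (0 : ℝ) < r / 2 / (L + 1) := by positivity
  have hεL : (L + 1) * ((r : ℝ) / 2 / (L + 1)) ≤ r - (r / 2 : NNReal) := by
    rw [mul_div_cancel₀ _ (by positivity)]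
    push_cast; linarith
  set ε : ℝ := r / 2 / (L + 1)
  have h0ε : (0 : ℝ) ∈ Ioo (-ε) ε := by simpa using hε
  set W := Ψ.source ∩ Ψ ⁻¹' Metric.ball (Ψ z₀) (r / 2 : NNReal) with hW
  have hWo : IsOpen W := Ψ.isOpen_inter_preimage Metric.isOpen_ball
  have hz₀W : z₀ ∈ W := ⟨hz₀, Metric.mem_ball_self (by push_cast; positivity)⟩
  have key : ∀ z ∈ W, ∀ h ∈ Ioo (-ε) ε, h ∈ S.maxDomain z ∧ S.flow z h ∈ Ψ.source ∧
      Ψ (S.flow z h) ∈ Metric.closedBall (Ψ z₀) r ∧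
      HasDerivAt (fun h => Ψ (S.flow z h)) (f (Ψ (S.flow z h))) h := by
    intro z hz h hh
    obtain ⟨α, hα0, hα⟩ := exists_hasDerivAt_mem_closedBall hε hcf hL hεL
      (Metric.ball_subset_closedBall hz.2)
    have h1 : ∀ h ∈ Ioo (-ε) ε, h ∈ S.maxDomain z ∧ S.flow z h = Ψ.symm (α h) := fun h hh =>
      phaseChart_symm_eq_flow hgeo hε (fun s hs => ⟨(hα s hs).1, (hball (hα s hs).2).1⟩) hz.1 hα0 hh
    have h2 : ∀ h ∈ Ioo (-ε) ε, Ψ (S.flow z h) = α h := fun h hh => by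
      rw [(h1 h hh).2, Ψ.right_inv (hball (hα h hh).2).1]
    refine ⟨(h1 h hh).1, ?_, ?_, ?_⟩
    · rw [(h1 h hh).2]; exact Ψ.map_target (hball (hα h hh).2).1
    · rw [h2 h hh]; exact (hα h hh).2
    · rw [h2 h hh]
      refine (hα h hh).1.congr_of_eventuallyEq ?_
      filter_upwards [Ioo_mem_nhds hh.1 hh.2] with q hq using h2 q hq
  refine ⟨ε, hε, W, hWo.mem_nhds hz₀W, hWo, fun z hz h hh => ?_⟩
  obtain ⟨k1, k2, k3, -⟩ := key z hz h hh
  refine ⟨k1, ?_, ?_⟩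
  · have := (hball k3).2
    rwa [mem_preimage, Ψ.left_inv k2] at this
  -- Along any ultrafilter converging to `z`, the trajectories converge to a solution starting at
  -- `z`, which by uniqueness is the flow of `z`.
  · rw [ContinuousAt, tendsto_iff_ultrafilter]
    intro l hl
    have hlW : ∀ᶠ z' in (l : Filter (TangentBundle I4 M)), z' ∈ W := hl (hWo.mem_nhds hz)
    obtain ⟨β, hβ⟩ := exists_hasDerivAt_of_ultrafilter l hK hcf (g := fun _ => f)
      (α := fun z' h => Ψ (S.flow z' h)) (a := -ε) (b := ε)
      (fun η hη => Eventually.of_forall fun _ x _ => by simpa using hη.le)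
      (hlW.mono fun z' hz' h hh => ⟨(key z' hz' h hh).2.2.2, (key z' hz' h hh).2.2.1⟩)
    have hβ0 : β 0 = Ψ z := by
      have h1 := (hβ 0 h0ε).2.2
      simp only [flow_zero hgeo] at h1
      exact tendsto_nhds_unique h1 ((Ψ.continuousAt hz.1).tendsto.mono_left hl)
    have h2 : S.flow z h = Ψ.symm (β h) := (phaseChart_symm_eq_flow hgeo hε
      (fun s hs => ⟨(hβ s hs).2.1, (hball (hβ s hs).1).1⟩) hz.1 hβ0 hh).2
    rw [h2]
    refine ((Ψ.continuousAt_symm (hball (hβ h hh).1).1).tendsto.comp (hβ h hh).2.2).congr' ?_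
    filter_upwards [hlW] with z' hz'
    exact Ψ.left_inv (key z' hz' h hh).2.1

/-- The geodesic flow exists for a uniform time near a compact set. -/
theorem exists_uniform_flow_of_isCompact {K O : Set (TangentBundle I4 M)} (hK : IsCompact K)
    (hO : IsOpen O) (hKO : K ⊆ O) : ∃ ε > 0, ∀ z ∈ K, ∀ h ∈ Ioo (-ε) ε,
      h ∈ S.maxDomain z ∧ ContinuousAt (fun z => S.flow z h) z ∧
      ∀ᶠ z' in 𝓝 z, ∀ h ∈ Ioo (-ε) ε, h ∈ S.maxDomain z' ∧ S.flow z' h ∈ O := by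
  refine hK.induction_on (p := fun K' => ∃ ε > 0, ∀ z ∈ K', ∀ h ∈ Ioo (-ε) ε,
      h ∈ S.maxDomain z ∧ ContinuousAt (fun z => S.flow z h) z ∧
      ∀ᶠ z' in 𝓝 z, ∀ h ∈ Ioo (-ε) ε, h ∈ S.maxDomain z' ∧ S.flow z' h ∈ O)
    ⟨1, one_pos, by simp⟩ (fun s t hst ⟨ε, hε, h⟩ => ⟨ε, hε, fun z hz => h z (hst hz)⟩) ?_ ?_
  · rintro s t ⟨ε₁, hε₁, h₁⟩ ⟨ε₂, hε₂, h₂⟩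
    have i₁ : Ioo (-(min ε₁ ε₂)) (min ε₁ ε₂) ⊆ Ioo (-ε₁) ε₁ :=
      Ioo_subset_Ioo (neg_le_neg (min_le_left _ _)) (min_le_left _ _)
    have i₂ : Ioo (-(min ε₁ ε₂)) (min ε₁ ε₂) ⊆ Ioo (-ε₂) ε₂ :=
      Ioo_subset_Ioo (neg_le_neg (min_le_right _ _)) (min_le_right _ _)
    refine ⟨min ε₁ ε₂, lt_min hε₁ hε₂, ?_⟩
    rintro z (hz | hz) h hh
    · obtain ⟨a, b, c⟩ := h₁ z hz h (i₁ hh)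
      exact ⟨a, b, c.mono fun z' hz' h hh => hz' h (i₁ hh)⟩
    · obtain ⟨a, b, c⟩ := h₂ z hz h (i₂ hh)
      exact ⟨a, b, c.mono fun z' hz' h hh => hz' h (i₂ hh)⟩
  · intro z hz
    obtain ⟨ε, hε, W, hW, hWo, h⟩ := exists_uniform_flow hgeo z (hO.mem_nhds (hKO hz))
    refine ⟨W, mem_nhdsWithin_of_mem_nhds hW, ε, hε, fun z' hz' q hq => ⟨(h z' hz' q hq).1,
      (h z' hz' q hq).2.2, ?_⟩⟩
    filter_upwards [hWo.mem_nhds hz'] with z'' hz'' q hq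
    exact ⟨(h z'' hz'' q hq).1, (h z'' hz'' q hq).2.1⟩

/-- Continuous dependence of geodesics on the initial position and velocity. -/
theorem eventually_flow_mem {z₀ : TangentBundle I4 M} {b : ℝ} (hb : 0 ≤ b)
    (hbD : b ∈ S.maxDomain z₀) {O : Set (TangentBundle I4 M)} (hO : IsOpen O)
    (hzO : ∀ s ∈ Icc 0 b, S.flow z₀ s ∈ O) :
    (∀ᶠ z in 𝓝 z₀, ∀ s ∈ Icc 0 b, s ∈ S.maxDomain z ∧ S.flow z s ∈ O) ∧
      ContinuousAt (fun z => S.flow z b) z₀ := by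
  have hsub : Icc 0 b ⊆ S.maxDomain z₀ :=
    (ordConnected_maxDomain z₀).out (zero_mem_maxDomain hgeo z₀) hbD
  have hc : ContinuousOn (S.flow z₀) (Icc 0 b) :=
    ((isGeodesicOn_maxGeodesic hgeo z₀).continuousOn_tangentLift (isOpen_maxDomain z₀)).mono hsub
  obtain ⟨ε, hε, h⟩ := exists_uniform_flow_of_isCompact hgeo (isCompact_Icc.image_of_continuousOn hc)
    hO (image_subset_iff.2 hzO)
  have hε2 : ε / 2 ∈ Ioo (-ε) ε := ⟨by linarith, by linarith⟩
  -- Steps of `ε / 2` stay below the uniform existence time. Continuity at the last parameter is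
  -- carried along so that the flow can be restarted there.
  have step : ∀ n : ℕ, ∀ s ∈ Icc 0 b, s ≤ n * (ε / 2) →
      (∀ᶠ z in 𝓝 z₀, ∀ r ∈ Icc 0 s, r ∈ S.maxDomain z ∧ S.flow z r ∈ O) ∧
      ContinuousAt (fun z => S.flow z s) z₀ := by
    intro n
    induction n with
    | zero =>
      intro s hs hs'
      obtain rfl : s = 0 := le_antisymm (by simpa using hs') hs.1
      simp only [flow_zero hgeo, Icc_self, mem_singleton_iff, forall_eq]
      refine ⟨?_, continuousAt_id⟩
      filter_upwards [hO.mem_nhds (by simpa [flow_zero hgeo] using hzO 0 hs)] with z hz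
      exact ⟨zero_mem_maxDomain hgeo z, hz⟩
    | succ n ih =>
      intro s hs hs'
      set a := max 0 (s - ε / 2) with ha
      have ha0 : 0 ≤ a := le_max_left _ _
      have has : a ≤ s := max_le hs.1 (by linarith)
      have haε : s - a < ε := by have := le_max_right 0 (s - ε / 2); linarith
      have hab : a ∈ Icc 0 b := ⟨ha0, has.trans hs.2⟩
      obtain ⟨ih1, ih2⟩ := ih a hab (max_le (by positivity) (by push_cast at hs'; linarith))
      have hloc := fun q hq => h _ (mem_image_of_mem _ hab) q hq
      have hev : ∀ᶠ z in 𝓝 z₀, ∀ q ∈ Ioo (-ε) ε, q ∈ S.maxDomain (S.flow z a) ∧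
          S.flow (S.flow z a) q ∈ O :=
        ih2.eventually (hloc _ hε2).2.2
      have hev2 : ∀ᶠ z in 𝓝 z₀, ∀ r ∈ Icc 0 s, r ∈ S.maxDomain z ∧ S.flow z r ∈ O ∧
          (a ≤ r → S.flow (S.flow z a) (r - a) = S.flow z r) := by
        filter_upwards [ih1, hev] with z hz1 hz2 r hr
        have haD := (hz1 a ⟨ha0, le_rfl⟩).1
        by_cases har : a ≤ r
        · obtain ⟨h1, h2⟩ := hz2 (r - a) ⟨by linarith, by linarith [hr.2]⟩
          obtain ⟨h3, h4⟩ := flow_add hgeo haD h1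
          rw [add_sub_cancel] at h3 h4
          exact ⟨h3, h4 ▸ h2, fun _ => h4⟩
        · obtain ⟨h1, h2⟩ := hz1 r ⟨hr.1, (not_le.1 har).le⟩
          exact ⟨h1, h2, fun h => absurd h har⟩
      refine ⟨hev2.mono fun z hz r hr => ⟨(hz r hr).1, (hz r hr).2.1⟩, ?_⟩
      have hca : ContinuousAt (fun z => S.flow (S.flow z a) (s - a)) z₀ :=
        ContinuousAt.comp (g := fun z => S.flow z (s - a)) (f := fun z => S.flow z a)
          (hloc (s - a) ⟨by linarith, haε⟩).2.1 ih2
      refine hca.congr ?_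
      filter_upwards [hev2] with z hz
      exact (hz s ⟨hs.1, le_rfl⟩).2.2 has
  obtain ⟨n, hn⟩ := exists_nat_ge (b / (ε / 2))
  exact step n b ⟨hb, le_rfl⟩ (by rwa [div_le_iff₀ (by positivity)] at hn)

end Flow

/-! ### Causal character along geodesics -/

variable (S) in
theorem exists_basis_g_eq (x : M) : ∃ b : Module.Basis (Fin 4) ℝ (TangentSpace I4 x), ∀ u v,
    S.g x u v = -(b.repr u 0 * b.repr v 0) + b.repr u 1 * b.repr v 1 + b.repr u 2 * b.repr v 2
      + b.repr u 3 * b.repr v 3 := by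
  obtain ⟨b, hb⟩ := S.lorentzian x
  refine ⟨b, fun u v => ?_⟩
  conv_lhs => rw [← b.sum_repr u, ← b.sum_repr v]
  have h0 : ∀ u' : TangentSpace I4 x, S.g x (b.repr u 0 • b 0 + b.repr u 1 • b 1 + b.repr u 2 • b 2
      + b.repr u 3 • b 3) u' = b.repr u 0 * S.g x (b 0) u' + b.repr u 1 * S.g x (b 1) u'
      + b.repr u 2 * S.g x (b 2) u' + b.repr u 3 * S.g x (b 3) u' := fun u' => by simp
  rw [Fin.sum_univ_four, Fin.sum_univ_four, h0]
  simp only [map_add, map_smul, smul_eq_mul, hb]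
  simp

theorem sq_inner_le (a b c x y z : ℝ) : (a * x + b * y + c * z) ^ 2 ≤
    (a ^ 2 + b ^ 2 + c ^ 2) * (x ^ 2 + y ^ 2 + z ^ 2) := by
  nlinarith [sq_nonneg (a * y - b * x), sq_nonneg (a * z - c * x), sq_nonneg (b * z - c * y)]

/-- With time components `a`, `c` and squared spatial length `p < a²` of `u`, orthogonality and
Cauchy–Schwarz give `a²c² ≤ p c²`. Hence `c = 0`, and a null vector without time component vanishes.
-/
theorem g_ne_zero_of_null {x : M} {u v : TangentSpace I4 x} (hu : S.g x u u < 0) (hv : v ≠ 0)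
    (hvn : S.g x v v = 0) : S.g x u v ≠ 0 := by
  obtain ⟨b, hb⟩ := S.exists_basis_g_eq x
  intro h
  rw [hb] at hu hvn h
  have hcs := sq_inner_le (b.repr u 1) (b.repr u 2) (b.repr u 3) (b.repr v 1) (b.repr v 2)
    (b.repr v 3)
  set a := b.repr u 0
  set p := b.repr u 1 ^ 2 + b.repr u 2 ^ 2 + b.repr u 3 ^ 2 with hp
  set c := b.repr v 0 with hc
  have hpa : p < a ^ 2 := by rw [hp]; linarith
  have e1 : b.repr v 1 ^ 2 + b.repr v 2 ^ 2 + b.repr v 3 ^ 2 = c ^ 2 := by linarith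
  have e2 : b.repr u 1 * b.repr v 1 + b.repr u 2 * b.repr v 2 + b.repr u 3 * b.repr v 3 = a * c := by
    linarith
  rw [e1, e2] at hcs
  have hc0 : c = 0 := by
    by_contra hne
    have : 0 < c ^ 2 := by positivity
    nlinarith
  rw [hc0] at e1
  refine hv (b.repr.injective (Finsupp.ext fun i => ?_))
  rw [map_zero, Finsupp.zero_apply]
  fin_cases i
  · exact hc0
  all_goals
    refine pow_eq_zero_iff (n := 2) (by norm_num) |>.1 ?_
    simp only [Fin.mk_one, Fin.reduceFinMk]
    nlinarith [sq_nonneg (b.repr v 1), sq_nonneg (b.repr v 2), sq_nonneg (b.repr v 3)]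

/-- Twice the geodesic equation tested against the velocity is the derivative of `g(γ', γ')`. -/
theorem IsGeodesicOn.hasDerivAt_energy {γ : ℝ → M} {J : Set ℝ} (h : S.IsGeodesicOn γ J)
    (hJ : IsOpen J) {s : ℝ} (hs : s ∈ J) :
    HasDerivAt (fun r => S.g (γ r) (velocity γ r) (velocity γ r)) 0 s := by
  set e := chartAt E4 (γ s)
  have he : e ∈ atlas E4 M := chart_mem_atlas E4 (γ s)
  have hse : γ s ∈ e.source := mem_chart_source E4 (γ s)
  have hev : (fun r => S.g (γ r) (velocity γ r) (velocity γ r)) =ᶠ[𝓝 s]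
      fun r => inChart S.g e (e (γ r)) (deriv (e ∘ γ) r) (deriv (e ∘ γ) r) := by
    filter_upwards [hJ.mem_nhds hs, (h.continuousAt hJ hs).eventually
      (e.open_source.mem_nhds hse)] with r hr hr'
    rw [← mfderiv_velocity he hr' (h.mdifferentiableAt hJ hr)]
    exact S.g_eq_inChart he hr' _ _
  refine HasDerivAt.congr_of_eventuallyEq ?_ hev
  obtain ⟨h1, h2⟩ := h.2 e he s hs hse
  have hx : HasDerivAt (e ∘ γ) (deriv (e ∘ γ) s) s :=
    (h1.differentiableAt (by norm_num)).hasDerivAt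
  have hx' : HasDerivAt (deriv (e ∘ γ)) (deriv (deriv (e ∘ γ)) s) s :=
    ((contDiffAt_deriv_curve h1).differentiableAt (by norm_num)).hasDerivAt
  have hG : HasDerivAt (fun r => inChart S.g e (e (γ r)))
      (fderiv ℝ (inChart S.g e) (e (γ s)) (deriv (e ∘ γ) s)) s :=
    HasFDerivAt.comp_hasDerivAt (l := inChart S.g e) (f := e ∘ γ) s
      (S.differentiableAt_inChart he (e.map_source hse)).hasFDerivAt hx
  have h3 := (hG.clm_apply hx').clm_apply hx'
  convert! h3 using 1
  have h4 := h2 (deriv (e ∘ γ) s)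
  have h5 := S.inChart_symm e (e (γ s)) (deriv (e ∘ γ) s) (deriv (deriv (e ∘ γ)) s)
  rw [_root_.add_apply]
  linarith

section Flow

variable (hgeo : S.HasUniqueGeodesics)
include hgeo

theorem flow_zero_velocity (q : M) (s : ℝ) : S.flow ⟨q, 0⟩ s = ⟨q, 0⟩ := by
  have hg : S.IsGeodesicOn (fun _ => q) univ := by
    refine ⟨continuousOn_const, fun e he s _ hs => ⟨contDiffAt_const, fun w => ?_⟩⟩
    have h1 : deriv (e ∘ fun _ : ℝ => q) = fun _ => 0 := by
      ext1 r; exact deriv_const r (e q)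
    simp [h1]
  have hl : ∀ s, tangentLift (fun _ : ℝ => q) s = ⟨q, 0⟩ := by
    intro s
    have : velocity (fun _ : ℝ => q) s = 0 := by
      rw [velocity, mfderiv_const]; rfl
    exact congrArg (fun v => (⟨q, v⟩ : TangentBundle I4 M)) this
  have := flow_eq hgeo isOpen_univ ordConnected_univ (mem_univ _) hg (mem_univ s)
  rwa [hl, hl] at this

/-- Flowing back from a zero velocity gives a constant geodesic, so the initial velocity would be
zero. -/
theorem flow_snd_ne_zero {z : TangentBundle I4 M} (hz : z.2 ≠ 0) {s : ℝ}
    (hs : s ∈ S.maxDomain z) : (S.flow z s).2 ≠ 0 := by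
  intro h
  have h1 : S.flow z s = ⟨(S.flow z s).1, 0⟩ :=
    congrArg (fun v => (⟨(S.flow z s).1, v⟩ : TangentBundle I4 M)) h
  have h2 := (flow_add_of_mem hgeo hs (h := -s) (by simpa using zero_mem_maxDomain hgeo z)).2
  rw [add_neg_cancel, flow_zero hgeo, h1, flow_zero_velocity hgeo] at h2
  rw [← h2] at hz
  exact hz rfl

theorem g_flow_eq (z : TangentBundle I4 M) {s : ℝ} (hs : s ∈ S.maxDomain z) :
    S.g (S.flow z s).1 (S.flow z s).2 (S.flow z s).2 = S.g z.1 z.2 z.2 := by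
  have hg := isGeodesicOn_maxGeodesic hgeo z
  have hJ := S.isOpen_maxDomain z
  have h1 := hJ.is_const_of_deriv_eq_zero (ordConnected_maxDomain z).isPreconnected
    (fun s hs => (hg.hasDerivAt_energy hJ hs).differentiableAt.differentiableWithinAt)
    (fun s hs => (hg.hasDerivAt_energy hJ hs).deriv) hs (zero_mem_maxDomain hgeo z)
  have h2 : ∀ z' : TangentBundle I4 M, z' = z → S.g z'.1 z'.2 z'.2 = S.g z.1 z.2 z.2 := by
    rintro _ rfl; rfl
  exact h1.trans (h2 (S.flow z 0) (flow_zero hgeo z))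

omit hgeo in
variable (S) in
theorem continuous_g_T : Continuous fun z : TangentBundle I4 M => S.g z.1 (S.T z.1) z.2 := by
  rw [continuous_iff_continuousAt]
  intro z₀
  set e := chartAt E4 z₀.1
  have he : e ∈ atlas E4 M := chart_mem_atlas E4 z₀.1
  have hz₀ : z₀.1 ∈ e.source := mem_chart_source E4 z₀.1
  have hproj : Continuous (fun z : TangentBundle I4 M => z.1) :=
    FiberBundle.continuous_proj E4 (TangentSpace I4)
  have hev : (fun z : TangentBundle I4 M => S.g z.1 (S.T z.1) z.2) =ᶠ[𝓝 z₀]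
      fun z => inChart S.g e (e z.1) (phaseChart z₀.1 ⟨z.1, S.T z.1⟩).2 (phaseChart z₀.1 z).2 := by
    filter_upwards [hproj.continuousAt.eventually (e.open_source.mem_nhds hz₀)] with z hz
    rw [phaseChart_apply (z := z) hz, phaseChart_apply (z := ⟨z.1, S.T z.1⟩) hz]
    exact S.g_eq_inChart he hz _ _
  refine ContinuousAt.congr ?_ hev.symm
  have h1 : ContinuousAt (fun z : TangentBundle I4 M => inChart S.g e (e z.1)) z₀ :=
    ContinuousAt.comp (g := inChart S.g e) (f := fun z : TangentBundle I4 M => e z.1)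
      (S.differentiableAt_inChart he (e.map_source hz₀)).continuousAt
      (ContinuousAt.comp (g := e) (f := fun z : TangentBundle I4 M => z.1)
        (e.continuousAt hz₀) hproj.continuousAt)
  have h2 : ContinuousAt (phaseChart z₀.1) z₀ :=
    (phaseChart z₀.1).continuousAt (mem_phaseChart_source.2 hz₀)
  have h3 : ContinuousAt (fun z : TangentBundle I4 M => phaseChart z₀.1 ⟨z.1, S.T z.1⟩) z₀ :=
    ContinuousAt.comp (g := phaseChart z₀.1)
      (f := fun z : TangentBundle I4 M => (⟨z.1, S.T z.1⟩ : TangentBundle I4 M))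
      ((phaseChart z₀.1).continuousAt (mem_phaseChart_source.2 hz₀))
      (S.continuous_T.comp hproj).continuousAt
  exact (h1.clm_apply h3.snd).clm_apply h2.snd

/-- `g(T, γ')` is continuous and, by `g_ne_zero_of_null`, never zero on the connected domain, so it
keeps its sign. -/
theorem futureNull_flow {z : TangentBundle I4 M} (hz : S.FutureNull z.2) {s : ℝ}
    (hs : s ∈ S.maxDomain z) : S.FutureNull (S.flow z s).2 := by
  have hnull : ∀ s ∈ S.maxDomain z, S.g _ (S.flow z s).2 (S.flow z s).2 = 0 := fun s hs =>
    (g_flow_eq hgeo z hs).trans hz.2.1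
  have hne : ∀ s ∈ S.maxDomain z, S.g _ (S.T (S.flow z s).1) (S.flow z s).2 ≠ 0 := fun s hs =>
    g_ne_zero_of_null (S.timelike_T _) (flow_snd_ne_zero hgeo hz.1 hs) (hnull s hs)
  refine ⟨flow_snd_ne_zero hgeo hz.1 hs, hnull s hs, ?_⟩
  have hc : ContinuousOn (fun s => S.g _ (S.T (S.flow z s).1) (S.flow z s).2) (S.maxDomain z) :=
    S.continuous_g_T.comp_continuousOn
      ((isGeodesicOn_maxGeodesic hgeo z).continuousOn_tangentLift (isOpen_maxDomain z))
  have h0 := zero_mem_maxDomain hgeo z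
  have hz0 : S.g _ (S.T (S.flow z 0).1) (S.flow z 0).2 < 0 := by
    rw [flow_zero hgeo]; exact hz.2.2
  by_contra hcon
  obtain ⟨r, hr, hr0⟩ := (ordConnected_maxDomain z).isPreconnected.intermediate_value h0 hs hc
    ⟨hz0.le, not_lt.1 hcon⟩
  exact hne r hr hr0

end Flow

/-! ### Maximal null geodesics as inextendible causal curves -/

theorem IsGeodesicOn.contMDiffAt {γ : ℝ → M} {J : Set ℝ} (h : S.IsGeodesicOn γ J)
    (hJ : IsOpen J) {s : ℝ} (hs : s ∈ J) : ContMDiffAt 𝓘(ℝ, ℝ) I4 1 γ s := by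
  set e := chartAt E4 (γ s)
  have he : e ∈ atlas E4 M := chart_mem_atlas E4 (γ s)
  have hse : γ s ∈ e.source := mem_chart_source E4 (γ s)
  have hev : γ =ᶠ[𝓝 s] e.symm ∘ (e ∘ γ) := by
    filter_upwards [(h.continuousAt hJ hs) (e.open_source.mem_nhds hse)] with r hr
    exact (e.left_inv hr).symm
  refine ContMDiffAt.congr_of_eventuallyEq ?_ hev
  have h1 : ContMDiffAt I4 I4 1 e.symm (e (γ s)) :=
    (contMDiffAt_symm_of_mem_maximalAtlas (IsManifold.subset_maximalAtlas he)
      (e.map_source hse) : ContMDiffAt I4 I4 ∞ e.symm (e (γ s))).of_le (by exact_mod_cast le_top)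
  exact h1.comp s ((h.2 e he s hs hse).1.of_le (by norm_num)).contMDiffAt

/-- A geodesic with causal future-directed velocity is a causal curve. -/
theorem IsGeodesicOn.isCausalCurveOn {γ : ℝ → M} {J : Set ℝ} (h : S.IsGeodesicOn γ J)
    (hJ : IsOpen J) (hγ : ∀ s ∈ J, S.FutureCausal (velocity γ s)) : S.IsCausalCurveOn γ J := by
  refine ⟨h.1, fun s hs U hU => mem_nhdsWithin_of_mem_nhds ?_⟩
  have hstep : ∀ a b, a < b → Icc a b ⊆ J → (∀ r ∈ Icc a b, γ r ∈ U) →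
      S.CausallyPrecedes U (γ a) (γ b) := by
    intro a b hab hsub hU
    refine Relation.ReflTransGen.single ⟨γ, a, b, hab,
      fun r hr => (h.contMDiffAt hJ (hsub hr)).contMDiffWithinAt, fun r hr => ?_, hU, rfl, rfl⟩
    rw [mfderivWithin_eq_mfderiv
      (uniqueMDiffWithinAt_iff_uniqueDiffWithinAt.2 (uniqueDiffOn_Icc hab r hr))
      (h.mdifferentiableAt hJ (hsub hr))]
    exact hγ r (hsub hr)
  have hne : ∀ᶠ r in 𝓝 s, r ≠ s → γ r ≠ γ s := by
    set e := chartAt E4 (γ s)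
    have he : e ∈ atlas E4 M := chart_mem_atlas E4 (γ s)
    have hse : γ s ∈ e.source := mem_chart_source E4 (γ s)
    have h1 := mfderiv_velocity he hse (h.mdifferentiableAt hJ hs)
    have h2 : deriv (e ∘ γ) s ≠ 0 := by
      rw [← h1]
      intro h0
      refine (hγ s hs).1 ((mfderiv_symm_mfderiv he hse (velocity γ s)).symm.trans ?_)
      rw [h0]
      exact map_zero (mfderiv I4 I4 e.symm (e (γ s)) : E4 →L[ℝ] E4)
    have h3 := ((h.2 e he s hs hse).1.differentiableAt (by norm_num)).hasDerivAt.eventually_ne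
      (c := e (γ s)) h2
    rw [eventually_nhdsWithin_iff] at h3
    filter_upwards [h3] with r hr hrs heq
    exact hr hrs (congrArg e heq)
  obtain ⟨δ, hδ, hball⟩ := Metric.mem_nhds_iff.1
    (inter_mem (hJ.mem_nhds hs) ((h.continuousAt hJ hs) hU))
  have hoc : (Metric.ball s δ).OrdConnected := (convex_ball s δ).ordConnected
  filter_upwards [hne, Metric.ball_mem_nhds s hδ] with r hr hrb
  have hss := Metric.mem_ball_self (x := s) hδ
  exact ⟨fun hsr => ⟨hstep s r hsr (fun q hq => (hball (hoc.out hss hrb hq)).1)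
      fun q hq => (hball (hoc.out hss hrb hq)).2, hr hsr.ne'⟩,
    fun hrs => ⟨hstep r s hrs (fun q hq => (hball (hoc.out hrb hss hq)).1)
      fun q hq => (hball (hoc.out hrb hss hq)).2, hr hrs.ne⟩⟩

set_option maxSynthPendingDepth 3 in
/-- Near each point, the size of null vectors is controlled by a linear functional. -/
theorem exists_functional_null (q : M) : ∃ (f : E4 →L[ℝ] ℝ) (c : ℝ), 0 < c ∧
    ∀ᶠ y in 𝓝 (chartAt E4 q q), ∀ w : E4, inChart S.g (chartAt E4 q) y w w = 0 →
      c * ‖w‖ ≤ |f w| := by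
  set e := chartAt E4 q
  have he : e ∈ atlas E4 M := chart_mem_atlas E4 q
  have hq : q ∈ e.source := mem_chart_source E4 q
  set G := inChart S.g e
  set f : E4 →L[ℝ] ℝ := G (e q) (mfderiv I4 I4 e q (S.T q)) with hf
  -- The functional is `g(T, ·)` at `q`. No nonzero null vector is orthogonal to `T`, so the two
  -- terms never vanish together, and `c` is their minimal maximum on the sphere.
  have hpos : ∀ w ∈ Metric.sphere (0 : E4) 1, 0 < max |f w| |G (e q) w w| := by
    intro w hw
    have hw0 : w ≠ 0 := by rintro rfl; simp at hw
    by_contra hcon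
    rw [not_lt, max_le_iff, abs_nonpos_iff, abs_nonpos_iff] at hcon
    refine g_ne_zero_of_null (S := S) (x := q) (v := (mfderiv I4 I4 e.symm (e q) w : E4)) (S.timelike_T q) ?_
      ((S.inChart_apply e hq w w).symm.trans hcon.2) ?_
    · intro h0
      refine hw0 ((mfderiv_mfderiv_symm he hq w).symm.trans ?_)
      rw [h0]
      exact map_zero (mfderiv I4 I4 e q : E4 →L[ℝ] E4)
    · refine (S.g_eq_inChart he hq _ _).trans ?_
      rw [mfderiv_mfderiv_symm he hq w]
      exact hcon.1
  obtain ⟨w₀, hw₀, hmin⟩ := (isCompact_sphere (0 : E4) 1).exists_isMinOn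
    (NormedSpace.sphere_nonempty.2 zero_le_one)
    (f := fun w => max |f w| |G (e q) w w|) (by fun_prop)
  set c := max |f w₀| |G (e q) w₀ w₀|
  have hc : 0 < c := hpos w₀ hw₀
  refine ⟨f, c, hc, ?_⟩
  have hGc : ContinuousAt G (e q) :=
    (S.differentiableAt_inChart he (e.map_source hq)).continuousAt
  have hGn : ContinuousAt (fun y => ‖G y - G (e q)‖) (e q) := (hGc.sub continuousAt_const).norm
  filter_upwards [hGn.eventually_lt_const (by rwa [sub_self, norm_zero] : ‖G (e q) - G (e q)‖ < c)]
    with y hy w hw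
  rcases eq_or_ne w 0 with rfl | hw0
  · simp
  have hn : 0 < ‖w‖ := norm_pos_iff.2 hw0
  set u : E4 := ‖w‖⁻¹ • w with hu
  have hu1 : ‖u‖ = 1 := by rw [hu, norm_smul, norm_inv, norm_norm, inv_mul_cancel₀ hn.ne']
  have hGu : G y u u = 0 := by
    rw [hu, map_smul, map_smul, _root_.smul_apply, hw]; simp
  -- A unit vector null at `y` is almost null at `q`, so the maximum must come from `|f u|`.
  have h1 : |G (e q) u u| < c := by
    have h2 := ContinuousLinearMap.le_opNorm₂ (G y - G (e q)) u u
    rw [hu1, mul_one, mul_one, _root_.sub_apply, _root_.sub_apply, hGu, zero_sub, norm_neg,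
      Real.norm_eq_abs] at h2
    linarith
  have h3 : c ≤ max |f u| |G (e q) u u| := hmin (by simpa using hu1)
  have h4 : c ≤ |f u| := (le_max_iff.1 h3).resolve_right (not_le.2 h1)
  rw [hu, map_smul, smul_eq_mul, abs_mul, abs_inv, abs_norm, ← div_eq_inv_mul,
    le_div_iff₀ hn] at h4
  exact h4

end Spacetime
/-- A positive function whose logarithmic derivative is controlled by the derivative of a bounded
function is bounded above and away from zero, and its primitive being bounded, the domain is
bounded. -/
theorem exists_bounds_of_abs_deriv_le {φ u u' : ℝ → ℝ} {D : Set ℝ} {C R s₁ : ℝ}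
    (hD : D.OrdConnected) (hC : 0 ≤ C) (hs₁ : s₁ ∈ D) (hle : ∀ s ∈ D, s₁ ≤ s)
    (hφ : ∀ s ∈ D, HasDerivAt φ (u s) s) (hu : ∀ s ∈ D, HasDerivAt u (u' s) s)
    (hpos : ∀ s ∈ D, 0 < u s) (hu' : ∀ s ∈ D, |u' s| ≤ C * u s ^ 2)
    (hR : ∀ s ∈ D, φ s - φ s₁ ≤ R) :
    (∃ B, ∀ s ∈ D, u s ≤ B) ∧ BddAbove D := by
  have hlog : ∀ s ∈ D, HasDerivAt (fun s => Real.log (u s)) (u' s / u s) s := fun s hs =>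
    (hu s hs).log (hpos s hs).ne'
  have hq : ∀ s ∈ D, |u' s / u s| ≤ C * u s := fun s hs => by
    rw [abs_div, abs_of_pos (hpos s hs), div_le_iff₀ (hpos s hs)]
    linarith [hu' s hs]
  have hconv : Convex ℝ D := convex_iff_ordConnected.2 hD
  -- Since `u = φ'`, the bound reads `|(log u)'| ≤ C φ'`; thus `log u` varies by at most `C` times
  -- the variation of `φ`.
  have hanti : AntitoneOn (fun s => Real.log (u s) - C * φ s) D := by
    have hd : ∀ s ∈ D, HasDerivAt (fun s => Real.log (u s) - C * φ s) (u' s / u s - C * u s) s :=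
      fun s hs => (hlog s hs).sub ((hφ s hs).const_mul C)
    refine antitoneOn_of_hasDerivWithinAt_nonpos hconv
      (fun s hs => (hd s hs).continuousAt.continuousWithinAt)
      (fun s hs => (hd s (interior_subset hs)).hasDerivWithinAt) fun s hs => ?_
    linarith [(abs_le.1 (hq s (interior_subset hs))).2]
  have hmono : MonotoneOn (fun s => Real.log (u s) + C * φ s) D := by
    have hd : ∀ s ∈ D, HasDerivAt (fun s => Real.log (u s) + C * φ s) (u' s / u s + C * u s) s :=
      fun s hs => (hlog s hs).add ((hφ s hs).const_mul C)
    refine monotoneOn_of_hasDerivWithinAt_nonneg hconv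
      (fun s hs => (hd s hs).continuousAt.continuousWithinAt)
      (fun s hs => (hd s (interior_subset hs)).hasDerivWithinAt) fun s hs => ?_
    linarith [(abs_le.1 (hq s (interior_subset hs))).1]
  refine ⟨⟨Real.exp (Real.log (u s₁) + C * R), fun s hs => ?_⟩, ?_⟩
  · rw [← Real.log_le_iff_le_exp (hpos s hs)]
    have h1 : Real.log (u s) - C * φ s ≤ Real.log (u s₁) - C * φ s₁ := hanti hs₁ hs (hle s hs)
    nlinarith [hR s hs]
  -- A lower bound `m` for `φ'`, with `φ` rising by at most `R`, limits the parameter to an interval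
  -- of length `R / m`.
  · set m := Real.exp (Real.log (u s₁) - C * R) with hm
    have hm0 : 0 < m := Real.exp_pos _
    have hmu : ∀ s ∈ D, m ≤ u s := fun s hs => by
      rw [← Real.le_log_iff_exp_le (hpos s hs)]
      have h1 : Real.log (u s₁) + C * φ s₁ ≤ Real.log (u s) + C * φ s := hmono hs₁ hs (hle s hs)
      nlinarith [hR s hs]
    have hmono2 : MonotoneOn (fun s => φ s - s * m) D := by
      have hd : ∀ s ∈ D, HasDerivAt (fun s => φ s - s * m) (u s - m) s := fun s hs => by
        have h1 := (hasDerivAt_id s).mul_const m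
        rw [one_mul] at h1
        exact (hφ s hs).sub h1
      refine monotoneOn_of_hasDerivWithinAt_nonneg hconv
        (fun s hs => (hd s hs).continuousAt.continuousWithinAt)
        (fun s hs => (hd s (interior_subset hs)).hasDerivWithinAt) fun s hs => ?_
      linarith [hmu s (interior_subset hs)]
    refine ⟨s₁ + R / m, fun s hs => ?_⟩
    have h1 : φ s₁ - s₁ * m ≤ φ s - s * m := hmono2 hs₁ hs (hle s hs)
    have h2 : (s - s₁) * m ≤ R := by nlinarith [hR s hs]
    have := (le_div_iff₀ hm0).2 h2
    linarith

namespace Spacetime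

theorem exists_norm_acceleration_inChart_le (q : M) : ∃ K ≥ 0, ∀ᶠ y in 𝓝 (chartAt E4 q q), ∀ v,
    ‖acceleration (inChart S.g (chartAt E4 q)) y v‖ ≤ K * ‖v‖ ^ 2 :=
  exists_norm_acceleration_le (chartAt E4 q).open_target
    (S.contDiff _ (chart_mem_atlas E4 q))
    (fun _ hy => S.isInvertible_inChart (chart_mem_atlas E4 q) hy) (mem_chart_target E4 q)

section Inextendible

variable (hgeo : S.HasUniqueGeodesics)
include hgeo

/-- A maximal null geodesic leaves small neighbourhoods of each point. -/
theorem exists_leaving_nhds {z : TangentBundle I4 M} (hz : z.2 ≠ 0) (hnull : S.g z.1 z.2 z.2 = 0)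
    (q : M) : ∃ U ∈ 𝓝 q, ∀ s₁ ∈ S.maxDomain z, ∃ s ∈ S.maxDomain z, s₁ ≤ s ∧
      S.maxGeodesic z s ∉ U := by
  set e := chartAt E4 q
  have he : e ∈ atlas E4 M := chart_mem_atlas E4 q
  have hq : q ∈ e.source := mem_chart_source E4 q
  obtain ⟨f₀, c, hc, hf₀⟩ := S.exists_functional_null q
  obtain ⟨K, hK, hacc⟩ := S.exists_norm_acceleration_inChart_le q
  obtain ⟨ρ, hρ, hball⟩ := Metric.nhds_basis_closedBall.mem_iff.1
    (inter_mem (inter_mem hf₀ hacc) (e.open_target.mem_nhds (e.map_source hq)))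
  refine ⟨e.source ∩ e ⁻¹' Metric.closedBall (e q) ρ, inter_mem (e.open_source.mem_nhds hq)
    (e.continuousAt hq (Metric.closedBall_mem_nhds _ hρ)), fun s₁ hs₁ => ?_⟩
  by_contra! hcon
  set γ := S.maxGeodesic z with hγ
  have hg : S.IsGeodesicOn γ (S.maxDomain z) := isGeodesicOn_maxGeodesic hgeo z
  have hJ := S.isOpen_maxDomain z
  have hoc := S.ordConnected_maxDomain z
  set D := S.maxDomain z ∩ Ici s₁ with hD
  have hDoc : D.OrdConnected := hoc.inter ordConnected_Ici
  set x := e ∘ γ with hx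
  have hsrc : ∀ s ∈ D, γ s ∈ e.source := fun s hs => (hcon s hs.1 hs.2).1
  have hbl : ∀ s ∈ D, x s ∈ Metric.closedBall (e q) ρ := fun s hs => (hcon s hs.1 hs.2).2
  have hga : ∀ s ∈ D, S.GeodesicAt e γ s := fun s hs => hg.2 e he s hs.1 (hsrc s hs)
  have hx1 : ∀ s ∈ D, HasDerivAt x (deriv x s) s := fun s hs =>
    ((hga s hs).1.differentiableAt (by norm_num)).hasDerivAt
  have hx2 : ∀ s ∈ D, HasDerivAt (deriv x) (acceleration (inChart S.g e) (x s) (deriv x s)) s :=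
    fun s hs => by
      have h1 := ((geodesicAt_iff he (hsrc s hs)).1 (hga s hs)).2
      have h2 := ((contDiffAt_deriv_curve (hga s hs).1).differentiableAt (by norm_num)).hasDerivAt
      rw [h1] at h2
      exact h2
  have hvel : ∀ s ∈ D, (mfderiv I4 I4 e (γ s) (velocity γ s) : E4) = deriv x s := fun s hs =>
    mfderiv_velocity he (hsrc s hs) (hg.mdifferentiableAt hJ hs.1)
  have hxnull : ∀ s ∈ D, inChart S.g e (x s) (deriv x s) (deriv x s) = 0 := fun s hs => by
    rw [← hvel s hs]
    exact (S.g_eq_inChart he (hsrc s hs) _ _).symm.trans ((g_flow_eq hgeo z hs.1).trans hnull)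
  have hxne : ∀ s ∈ D, deriv x s ≠ 0 := fun s hs h0 => by
    refine flow_snd_ne_zero hgeo hz hs.1 ?_
    refine (mfderiv_symm_mfderiv he (hsrc s hs) (velocity γ s)).symm.trans ?_
    rw [hvel s hs, h0]
    exact map_zero (mfderiv I4 I4 e.symm (e (γ s)) : E4 →L[ℝ] E4)
  have hs₁D : s₁ ∈ D := ⟨hs₁, self_mem_Ici⟩
  have hfx : ∀ s ∈ D, c * ‖deriv x s‖ ≤ |f₀ (deriv x s)| := fun s hs =>
    (hball (hbl s hs)).1.1 _ (hxnull s hs)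
  have hfne : ∀ s ∈ D, f₀ (deriv x s) ≠ 0 := fun s hs h0 => by
    have h1 := hfx s hs
    rw [h0, abs_zero] at h1
    have := mul_pos hc (norm_pos_iff.2 (hxne s hs))
    linarith
  -- `f₀` does not vanish on the velocities, so it has constant sign along the geodesic; replacing
  -- it by `-f₀` if necessary makes it positive.
  obtain ⟨f, hfpos, hff⟩ : ∃ f : E4 →L[ℝ] ℝ, (∀ s ∈ D, 0 < f (deriv x s)) ∧
      ∀ s ∈ D, c * ‖deriv x s‖ ≤ f (deriv x s) := by
    have hcont : ContinuousOn (fun s => f₀ (deriv x s)) D := fun s hs =>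
      (f₀.continuous.continuousAt.comp (hx2 s hs).continuousAt).continuousWithinAt
    by_cases h : ∀ s ∈ D, 0 < f₀ (deriv x s)
    · exact ⟨f₀, h, fun s hs => by simpa [abs_of_pos (h s hs)] using hfx s hs⟩
    · have h' : ∀ s ∈ D, f₀ (deriv x s) < 0 := by
        push Not at h
        obtain ⟨a, ha, ha0⟩ := h
        intro s hs
        by_contra hs0
        obtain ⟨r, hr, hr0⟩ := hDoc.isPreconnected.intermediate_value ha hs hcont
          ⟨ha0, not_lt.1 hs0⟩
        exact hfne r hr hr0
      exact ⟨-f₀, fun s hs => by simpa using h' s hs,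
        fun s hs => by simpa [abs_of_neg (h' s hs)] using hfx s hs⟩
  -- `C` combines `‖x''‖ ≤ K ‖x'‖²` with `c ‖x'‖ ≤ f(x')`; `R` bounds the variation of `f` over a
  -- ball of diameter at most `2ρ`.
  obtain ⟨⟨B, hB⟩, hbdd⟩ := exists_bounds_of_abs_deriv_le (φ := fun s => f (x s))
    (u := fun s => f (deriv x s))
    (u' := fun s => f (acceleration (inChart S.g e) (x s) (deriv x s)))
    (C := ‖f‖ * K / c ^ 2) (R := ‖f‖ * (ρ + ρ)) hDoc (by positivity) hs₁D (fun s hs => hs.2)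
    (fun s hs => f.hasFDerivAt.comp_hasDerivAt s (hx1 s hs))
    (fun s hs => f.hasFDerivAt.comp_hasDerivAt s (hx2 s hs)) hfpos (fun s hs => by
      have h1 := f.le_opNorm (acceleration (inChart S.g e) (x s) (deriv x s))
      have h2 := (hball (hbl s hs)).1.2 (deriv x s)
      have h3 : (c * ‖deriv x s‖) ^ 2 ≤ f (deriv x s) ^ 2 :=
        pow_le_pow_left₀ (by positivity) (hff s hs) 2
      rw [← Real.norm_eq_abs]
      calc _ ≤ ‖f‖ * (K * ‖deriv x s‖ ^ 2) := h1.trans (by gcongr)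
        _ = ‖f‖ * K / c ^ 2 * (c * ‖deriv x s‖) ^ 2 := by field_simp
        _ ≤ _ := by gcongr)
    (fun s hs => by
      have h1 := f.le_opNorm (x s - x s₁)
      have h2 : ‖x s - x s₁‖ ≤ ρ + ρ := by
        rw [← dist_eq_norm]
        exact (dist_triangle_right _ _ (e q)).trans (add_le_add (hbl s hs) (hbl s₁ hs₁D))
      rw [map_sub] at h1
      exact (le_abs_self _).trans (h1.trans (by gcongr)))
  -- Positions and velocities stay in a compact set, so from a parameter within `ε` of `b = sSup D`
  -- the geodesic continues to `b`. But `b` is not in the domain, which is open.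
  set Kc : Set (E4 × E4) := Metric.closedBall (e q) ρ ×ˢ Metric.closedBall 0 (B / c) with hKc
  have hKcomp : IsCompact Kc := (isCompact_closedBall _ _).prod (isCompact_closedBall _ _)
  have hKt : Kc ⊆ (phaseChart q).target := fun w hw => mem_phaseChart_target.2 (hball hw.1).2
  obtain ⟨ε, hε, hu⟩ := exists_uniform_flow_of_isCompact hgeo
    (hKcomp.image_of_continuousOn ((phaseChart q).continuousOn_symm.mono hKt)) isOpen_univ
    (subset_univ _)
  set b := sSup D
  have hbD : b ∉ S.maxDomain z := by
    intro hb
    obtain ⟨δ, hδ, hδD⟩ := Metric.nhds_basis_closedBall.mem_iff.1 (hJ.mem_nhds hb)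
    have h1 : b + δ ∈ D := ⟨hδD (by simp [abs_of_pos hδ]),
      (le_csSup hbdd hs₁D).trans (by linarith)⟩
    have := le_csSup hbdd h1
    linarith
  obtain ⟨s, hs, hsb⟩ := exists_lt_of_lt_csSup ⟨s₁, hs₁D⟩ (sub_lt_self b hε)
  have hsle := le_csSup hbdd hs
  have hmem : S.flow z s ∈ (phaseChart q).symm '' Kc := by
    refine ⟨phaseChart q (S.flow z s), ?_,
      (phaseChart q).left_inv (mem_phaseChart_source.2 (hsrc s hs))⟩
    have h1 : phaseChart q (S.flow z s) = phase e γ s :=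
      hg.phaseChart_tangentLift hJ hs.1 (hsrc s hs)
    rw [h1]
    refine ⟨hbl s hs, ?_⟩
    rw [mem_closedBall_zero_iff, le_div_iff₀ hc, mul_comm]
    exact (hff s hs).trans (hB s hs)
  have h2 := (flow_add hgeo hs.1 (hu _ hmem (b - s) ⟨by linarith, by linarith⟩).1).1
  rw [add_sub_cancel] at h2
  exact hbD h2

/-- Maximal future-directed null geodesics are inextendible causal curves. -/
theorem isInextendibleCausalCurveOn_maxGeodesic {z : TangentBundle I4 M}
    (hz : S.FutureNull z.2) :
    S.IsInextendibleCausalCurveOn (S.maxGeodesic z) (S.maxDomain z) := by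
  have hne : Nonempty (S.maxDomain z) := ⟨⟨0, zero_mem_maxDomain hgeo z⟩⟩
  refine ⟨⟨0, zero_mem_maxDomain hgeo z⟩, S.ordConnected_maxDomain z,
    (isGeodesicOn_maxGeodesic hgeo z).isCausalCurveOn (S.isOpen_maxDomain z) fun s hs => ?_,
    fun q hq => ?_, fun q hq => ?_⟩
  · obtain ⟨h1, h2, h3⟩ := futureNull_flow hgeo hz hs
    exact ⟨h1, h2.le, h3⟩
  · obtain ⟨U, hU, h⟩ := exists_leaving_nhds hgeo hz.1 hz.2.1 q
    obtain ⟨s₁, hs₁⟩ := eventually_atTop.1 (hq hU)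
    obtain ⟨s, hs, hle, hnot⟩ := h s₁ s₁.2
    exact hnot (hs₁ ⟨s, hs⟩ hle)
  -- The past end is the future end of the reversed geodesic; `exists_leaving_nhds` does not ask for
  -- a future-directed velocity.
  · obtain ⟨U, hU, h⟩ := exists_leaving_nhds hgeo (z := ⟨z.1, -z.2⟩) (neg_ne_zero.2 hz.1)
      (by simpa using hz.2.1) q
    obtain ⟨s₁, hs₁⟩ := eventually_atBot.1 (hq hU)
    obtain ⟨s, hs, hle, hnot⟩ := h (-s₁) (maxDomain_neg hgeo s₁.2).1
    obtain ⟨h1, h2⟩ := maxDomain_neg hgeo hs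
    have h3 : (⟨z.1, - -z.2⟩ : TangentBundle I4 M) = z := by rw [neg_neg]
    rw [h3] at h1 h2
    rw [← h2] at hnot
    exact hnot (hs₁ ⟨-s, h1⟩ (neg_le.1 hle))

end Inextendible

/-! ### The null cone and the space of null geodesics -/

variable (S) in
/-- The cone of future-directed null vectors at a point is path connected. -/
theorem isPathConnected_futureNull (x : M) :
    IsPathConnected {v : TangentSpace I4 x | S.FutureNull v} := by
  obtain ⟨b, hb⟩ := S.exists_basis_g_eq x
  set a := b.repr (S.T x) 0
  set t₁ := b.repr (S.T x) 1
  set t₂ := b.repr (S.T x) 2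
  set t₃ := b.repr (S.T x) 3
  have hT : t₁ ^ 2 + t₂ ^ 2 + t₃ ^ 2 < a ^ 2 := by
    have := S.timelike_T x
    rw [hb] at this
    linarith
  -- `σ` is the sign of the time component of `T`; the basis need not be future-oriented.
  obtain ⟨σ, hσ, hσa⟩ : ∃ σ : ℝ, σ ^ 2 = 1 ∧ 0 < σ * a := by
    rcases lt_trichotomy a 0 with h | h | h
    · exact ⟨-1, by norm_num, by linarith⟩
    · rw [h] at hT
      nlinarith [sq_nonneg t₁, sq_nonneg t₂, sq_nonneg t₃]
    · exact ⟨1, by norm_num, by linarith⟩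
  have hnorm : ∀ y : EuclideanSpace ℝ (Fin 3), ‖y‖ ^ 2 = y 0 ^ 2 + y 1 ^ 2 + y 2 ^ 2 := fun y => by
    rw [EuclideanSpace.real_norm_sq_eq, Fin.sum_univ_three]
  have hdot : ∀ y : EuclideanSpace ℝ (Fin 3), y ≠ 0 →
      |t₁ * y 0 + t₂ * y 1 + t₃ * y 2| < σ * a * ‖y‖ := by
    intro y hy
    have hy0 : 0 < ‖y‖ := norm_pos_iff.2 hy
    refine abs_lt_of_sq_lt_sq ?_ (by positivity)
    have h1 := sq_inner_le t₁ t₂ t₃ (y 0) (y 1) (y 2)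
    rw [← hnorm y] at h1
    have h2 : (σ * a * ‖y‖) ^ 2 = a ^ 2 * ‖y‖ ^ 2 := by
      rw [mul_pow, mul_pow, hσ, one_mul]
    rw [h2]
    have h3 : 0 < ‖y‖ ^ 2 := by positivity
    nlinarith
  -- Nullness fixes the time component up to sign as `± ‖y‖`, and `g(T, v) < 0` selects `σ ‖y‖`.
  set ψ : EuclideanSpace ℝ (Fin 3) → TangentSpace I4 x := fun y =>
    (σ * ‖y‖) • b 0 + y 0 • b 1 + y 1 • b 2 + y 2 • b 3 with hψ
  have hψc : Continuous ψ := by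
    have h : ∀ w : E4, ∀ f : EuclideanSpace ℝ (Fin 3) → ℝ, Continuous f →
      Continuous fun y => f y • w := fun w f hf => hf.smul continuous_const
    have h1 : ∀ i, Continuous fun y : EuclideanSpace ℝ (Fin 3) => y i := fun i => by fun_prop
    exact (((h (b 0) _ (by fun_prop)).add (h (b 1) _ (h1 0))).add (h (b 2) _ (h1 1))).add
      (h (b 3) _ (h1 2))
  have c0 : ∀ y, b.repr (ψ y) 0 = σ * ‖y‖ := fun y => by simp [hψ]
  have c1 : ∀ y, b.repr (ψ y) 1 = y 0 := fun y => by simp [hψ]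
  have c2 : ∀ y, b.repr (ψ y) 2 = y 1 := fun y => by simp [hψ]
  have c3 : ∀ y, b.repr (ψ y) 3 = y 2 := fun y => by simp [hψ]
  have himage : {v : TangentSpace I4 x | S.FutureNull v} = ψ '' {0}ᶜ := by
    ext v
    constructor
    · rintro ⟨hv0, hvn, hvT⟩
      rw [hb] at hvn hvT
      set y : EuclideanSpace ℝ (Fin 3) := !₂[b.repr v 1, b.repr v 2, b.repr v 3] with hy
      have hy0 : y 0 = b.repr v 1 := rfl
      have hy1 : y 1 = b.repr v 2 := rfl
      have hy2 : y 2 = b.repr v 3 := rfl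
      have hn := hnorm y
      rw [hy0, hy1, hy2] at hn
      have hsq : (b.repr v 0) ^ 2 = (σ * ‖y‖) ^ 2 := by rw [mul_pow, hσ]; linarith
      have hext : b.repr v 0 = σ * ‖y‖ → ψ y = v := fun h0 => by
        refine b.repr.injective (Finsupp.ext fun i => ?_)
        fin_cases i
        · exact (c0 y).trans h0.symm
        · exact c1 y
        · exact c2 y
        · exact c3 y
      have hyne : y ≠ 0 := by
        intro h
        have h1 : ψ y = v := hext (by
          have h2 : b.repr v 0 ^ 2 = 0 := by rw [hsq, h]; simp
          rw [h, norm_zero, mul_zero]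
          exact pow_eq_zero_iff (by norm_num) |>.1 h2)
        rw [h] at h1
        exact hv0 (by rw [← h1]; simp [hψ])
      refine ⟨y, hyne, hext ?_⟩
      rcases sq_eq_sq_iff_eq_or_eq_neg.1 hsq with h | h
      · exact h
      · have h1 := (abs_lt.1 (hdot y hyne)).1
        rw [hy0, hy1, hy2] at h1
        rw [h] at hvT
        linarith
    · rintro ⟨y, hy, rfl⟩
      have hy' : y ≠ 0 := hy
      refine ⟨fun h => hy' ?_, ?_, ?_⟩
      · have h1 := c0 y
        have h2 : b.repr (0 : TangentSpace I4 x) 0 = 0 := by simp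
        rw [h, h2] at h1
        have hσ0 : σ ≠ 0 := by rintro rfl; simp at hσ
        exact norm_eq_zero.1 ((mul_eq_zero.1 h1.symm).resolve_left hσ0)
      · rw [hb, c0, c1, c2, c3]
        have := hnorm y
        have h2 : σ * ‖y‖ * (σ * ‖y‖) = ‖y‖ ^ 2 := by
          rw [← one_mul (‖y‖ ^ 2), ← hσ]; ring
        linarith
      · rw [hb, c0, c1, c2, c3]
        have h1 := (abs_lt.1 (hdot y hy')).2
        linarith
  rw [himage]
  refine IsPathConnected.image (isPathConnected_compl_singleton_of_one_lt_rank ?_ 0) hψc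
  rw [← Module.finrank_eq_rank, finrank_euclideanSpace_fin]
  norm_num

theorem IsCausalCurveOn.mono {γ : ℝ → M} {I J : Set ℝ} (h : S.IsCausalCurveOn γ J) (hI : I ⊆ J) :
    S.IsCausalCurveOn γ I :=
  ⟨h.1.mono hI, fun s hs U hU => (h.2 s (hI hs) U hU).filter_mono (nhdsWithin_mono s hI)⟩

/-- The map that sends a causal curve to its endpoint. -/
theorem exists_continuous_endpoint {τ : M → ℝ} (hτ : S.IsCauchySlicing τ) (p : M) (t : ℝ) :
    ∃ E : S.CausalCurve p (slice τ t) → M, Continuous E ∧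
      ∀ c, c.carrier ∩ slice τ t = {E c} := by
  have h : ∀ c : S.CausalCurve p (slice τ t), ∃ q, c.carrier ∩ slice τ t = {q} ∧
      c.carrier ⊆ {q} ∪ {x | τ x < t} := by
    intro c
    obtain ⟨γ, a, b, hab, hγ, -, hb, hc⟩ := c.isCausal
    have hmono := hτ.2.1 γ _ ordConnected_Icc hγ
    have hbt : τ (γ b) = t := hb
    have hlt : ∀ s ∈ Icc a b, s ≠ b → τ (γ s) < t := fun s hs hsb => by
      rw [← hbt]
      exact hmono hs (right_mem_Icc.2 hab) (lt_of_le_of_ne hs.2 hsb)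
    have hbc : γ b ∈ c.carrier := hc ▸ mem_image_of_mem _ (right_mem_Icc.2 hab)
    have hsub : c.carrier ⊆ {γ b} ∪ {x | τ x < t} := by
      rw [← hc]
      rintro _ ⟨s, hs, rfl⟩
      rcases eq_or_ne s b with rfl | hne
      · exact Or.inl rfl
      · exact Or.inr (hlt s hs hne)
    refine ⟨γ b, Subset.antisymm (fun x hx => ?_) (singleton_subset_iff.2 ⟨hbc, hb⟩), hsub⟩
    rcases hsub hx.1 with h | h
    · exact h
    · exact absurd hx.2 (ne_of_lt h)
  choose E hE hsub using h
  refine ⟨E, continuous_def.2 fun V hV => ?_, hE⟩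
  have hmem : ∀ c, E c ∈ c.carrier ∩ slice τ t := fun c => by rw [hE c]; exact rfl
  -- A curve lies in `{τ < t}` except for its endpoint, so the endpoint is in `V` exactly when the
  -- curve lies in `V ∪ {τ < t}`: the preimage of `V` is a basic open set.
  refine TopologicalSpace.isOpen_generateFrom_of_mem
    ⟨V ∪ {x | τ x < t}, hV.union (isOpen_lt hτ.1 continuous_const), ?_⟩
  ext c
  constructor
  · intro hc x hx
    rcases hsub c hx with h | h
    · exact Or.inl (h ▸ hc)
    · exact Or.inr h
  · intro hc
    rcases hc (hmem c).1 with h | h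
    · exact h
    · exact absurd (hmem c).2 (ne_of_lt h)

/-- The null geodesics from `p` to a slice are parametrized continuously by their initial
velocities. -/
theorem exists_continuous_range_eq_nullGeodesics (hgeo : S.HasUniqueGeodesics) {τ : M → ℝ}
    (hτ : S.IsCauchySlicing τ) {p : M} {t : ℝ} (hp : 0 ≤ τ p) (hpt : τ p ≤ t) :
    ∃ F : {v : TangentSpace I4 p | S.FutureNull v} → S.CausalCurve p (slice τ t),
      Continuous F ∧ range F = S.nullGeodesics p (slice τ t) := by
  let z : {v : TangentSpace I4 p | S.FutureNull v} → TangentBundle I4 M := fun v => ⟨p, v⟩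
  have hzc : Continuous z :=
    (FiberBundle.continuous_totalSpaceMk E4 (TangentSpace I4) p).comp continuous_subtype_val
  have hinext := fun v => isInextendibleCausalCurveOn_maxGeodesic hgeo (z := z v) v.2
  have hmono := fun v => hτ.2.1 _ _ (ordConnected_maxDomain (z v)) (hinext v).2.2.1
  have hhit := fun v => hτ.2.2 t (hp.trans hpt) _ _ (hinext v)
  -- `σ v` is the parameter at which the geodesic meets the slice; it is nonnegative since `τ p ≤
  -- t`.
  choose σ hσ huniq using hhit
  have hσt : ∀ v, τ (S.maxGeodesic (z v) (σ v)) = t := fun v => (hσ v).2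
  have h0D := fun v => zero_mem_maxDomain hgeo (z v)
  have h0 : ∀ v, S.maxGeodesic (z v) 0 = p := fun v => maxGeodesic_zero hgeo (z v)
  have hσ0 : ∀ v, 0 ≤ σ v := fun v => by
    by_contra hcon
    have h1 : τ (S.maxGeodesic (z v) (σ v)) < τ (S.maxGeodesic (z v) 0) :=
      hmono v (hσ v).1 (h0D v) (not_le.1 hcon)
    rw [hσt, h0] at h1
    linarith
  have hsub : ∀ v, Icc 0 (σ v) ⊆ S.maxDomain (z v) := fun v =>
    (ordConnected_maxDomain (z v)).out (h0D v) (hσ v).1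
  let F : {v : TangentSpace I4 p | S.FutureNull v} → S.CausalCurve p (slice τ t) := fun v =>
    ⟨S.maxGeodesic (z v) '' Icc 0 (σ v), S.maxGeodesic (z v), 0, σ v, hσ0 v,
      (hinext v).2.2.1.mono (hsub v), h0 v, (hσ v).2, rfl⟩
  refine ⟨F, continuous_generateFrom_iff.2 ?_, Subset.antisymm ?_ ?_⟩
  · rintro _ ⟨U, hU, rfl⟩
    rw [isOpen_iff_mem_nhds]
    intro v₀ hv₀
    have hv₀' : ∀ s ∈ Icc 0 (σ v₀), S.maxGeodesic (z v₀) s ∈ U := fun s hs =>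
      hv₀ (mem_image_of_mem _ hs)
    have hnhds : S.maxDomain (z v₀) ∩ S.maxGeodesic (z v₀) ⁻¹' U ∈ 𝓝 (σ v₀) :=
      inter_mem ((isOpen_maxDomain (z v₀)).mem_nhds (hσ v₀).1)
        (((isGeodesicOn_maxGeodesic hgeo (z v₀)).continuousAt (isOpen_maxDomain _) (hσ v₀).1)
          (hU.mem_nhds (hv₀' _ ⟨hσ0 v₀, le_rfl⟩)))
    -- The geodesic is followed slightly past the slice, still inside `U`. Nearby ones stay in `U`
    -- up to `s₁` and have `τ > t` there, so they arrive before `s₁`; continuity of `σ` is not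
    -- needed.
    obtain ⟨δ, hδ, hball⟩ := Metric.nhds_basis_closedBall.mem_iff.1 hnhds
    have hδm : ∀ s, σ v₀ ≤ s → s ≤ σ v₀ + δ →
        s ∈ S.maxDomain (z v₀) ∧ S.maxGeodesic (z v₀) s ∈ U := fun s h1 h2 =>
      hball (by rw [Metric.mem_closedBall, Real.dist_eq, abs_of_nonneg (by linarith)]; linarith)
    set s₁ := σ v₀ + δ
    have hs₁ : 0 ≤ s₁ := add_nonneg (hσ0 v₀) hδ.le
    have hs₁D := (hδm s₁ (by linarith) le_rfl).1
    have hproj : Continuous (fun w : TangentBundle I4 M => w.1) :=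
      FiberBundle.continuous_proj E4 (TangentSpace I4)
    obtain ⟨hev, hcont⟩ := eventually_flow_mem hgeo hs₁ hs₁D (O := {w | w.1 ∈ U})
      (hU.preimage hproj) fun s hs => by
        rcases le_total s (σ v₀) with h | h
        · exact hv₀' s ⟨hs.1, h⟩
        · exact (hδm s h hs.2).2
    have hgt : t < τ (S.flow (z v₀) s₁).1 := by
      rw [← hσt v₀]
      exact hmono v₀ (hσ v₀).1 hs₁D (by linarith)
    have hev2 : ∀ᶠ w in 𝓝 (z v₀), t < τ (S.flow w s₁).1 :=
      ((hτ.1.comp hproj).continuousAt.comp (f := fun w => S.flow w s₁) hcont).eventually_const_lt hgt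
    filter_upwards [hzc.continuousAt.eventually hev, hzc.continuousAt.eventually hev2]
      with v h1 h2
    have hlt : σ v ≤ s₁ := by
      by_contra hcon
      have h3 : τ (S.maxGeodesic (z v) s₁) < τ (S.maxGeodesic (z v) (σ v)) :=
        hmono v (h1 s₁ ⟨hs₁, le_rfl⟩).1 (hσ v).1 (not_le.1 hcon)
      rw [hσt] at h3
      exact lt_asymm h2 h3
    rintro _ ⟨s, hs, rfl⟩
    exact (h1 s ⟨hs.1, hs.2.trans hlt⟩).2
  · rintro _ ⟨v, rfl⟩
    exact ⟨S.maxGeodesic (z v), S.maxDomain (z v), σ v, isOpen_maxDomain _,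
      ordConnected_maxDomain _, hσ0 v, hsub v, isGeodesicOn_maxGeodesic hgeo _,
      fun s hs => futureNull_flow hgeo (z := z v) v.2 hs, h0 v, (hσ v).2, rfl⟩
  · rintro c ⟨γ, J, b, hJ, hJc, hb0, hbJ, hγ, hnull, hγ0, hγb, hc⟩
    have h0J : (0 : ℝ) ∈ J := hbJ (left_mem_Icc.2 hb0)
    obtain ⟨v, hv⟩ : ∃ v, z v = tangentLift γ 0 := by
      have : ∀ q, ∀ w : TangentSpace I4 q, S.FutureNull w → q = p →
          ∃ v, z v = (⟨q, w⟩ : TangentBundle I4 M) := by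
        rintro _ w hw rfl
        exact ⟨⟨w, hw⟩, rfl⟩
      exact this _ _ (hnull 0 h0J) hγ0
    have heq : ∀ s ∈ J, s ∈ S.maxDomain (z v) ∧ S.maxGeodesic (z v) s = γ s := fun s hs => by
      rw [hv]; exact maxGeodesic_eq hgeo hJ hJc h0J hγ hs
    have hbJ' := hbJ (right_mem_Icc.2 hb0)
    -- The slice is met only once, so the given geodesic ends where the maximal one is cut off.
    have hbσ : b = σ v := huniq v b ⟨(heq b hbJ').1, by rw [(heq b hbJ').2]; exact hγb⟩
    refine ⟨v, CausalCurve.ext ?_⟩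
    rw [← hc, hbσ]
    exact image_congr fun s hs => (heq s (hbJ (hbσ ▸ hs))).2

end Spacetime

end Wavefront

theorem mainTheorem5 {M : Type*} [TopologicalSpace M] [T2Space M]
    [ChartedSpace Wavefront.E4 M] [IsManifold Wavefront.I4 ∞ M]
    (S : Wavefront.Spacetime M) (hS : S.GloballyHyperbolic) (hgeo : S.HasUniqueGeodesics)
    (τ : M → ℝ) (hτ : S.IsCauchySlicing τ)
    (p : M) (t : ℝ) (hp : 0 ≤ τ p) (hpt : τ p ≤ t) :
    IsPathConnected (S.wavefront p (Wavefront.Spacetime.slice τ t)) ∧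
      IsPathConnected (S.nullGeodesics p (Wavefront.Spacetime.slice τ t)) := by
  obtain ⟨F, hF, hrange⟩ :=
    Wavefront.Spacetime.exists_continuous_range_eq_nullGeodesics hgeo hτ hp hpt
  obtain ⟨E, hE, hEc⟩ := Wavefront.Spacetime.exists_continuous_endpoint hτ p t
  have hN : IsPathConnected (S.nullGeodesics p (Wavefront.Spacetime.slice τ t)) := by
    have := isPathConnected_iff_pathConnectedSpace.1 (S.isPathConnected_futureNull p)
    rw [← hrange]
    exact isPathConnected_range hF
  refine ⟨?_, hN⟩
  -- Each curve meets the slice exactly in its endpoint, so the wavefront is the image of `N` under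
  -- `E`.
  convert! hN.image hE
  ext q
  simp [Wavefront.Spacetime.wavefront, hEc, eq_comm]
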